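/- **Setting.** Let $\mathcal Q$ be a set of words on the letters $\bullet,\blacklozenge,\blacktriangle$. A word $w_1\cdots w_\ell\in\mathcal Q$ is identified with a necklace carrying, in clockwise cyclic order, one $\square$-pearl followed by pearls $w_1,\dots,w_\ell$. All graphs below are finite plane graphs whose vertices are copies of necklaces of $\mathcal Q$ and whose edges join pearls, the plane embedding being given by the cyclic order of pearls on the necklaces; one pearl is distinguished as the root, and graphs are considered up to isomorphism. Edges are black ($\bullet$–$\square$), red ($\blacklozenge$–$\square$) or blue ($\blacklozenge$–$\blacktriangle$). A pearl is free if it is incident to no edge. **Non-negative $\mathcal Q$-trees.** A $\mathcal Q$-tree is a tree with black and red edges, rooted at a $\square$-pearl, in which the root and all $\blacktriangle$-pearls are free and every other pearl is incident to exactly one edge. The excess of a pearl $x$ is the number of $\blacktriangle$-pearls minus the number of $\blacklozenge$-pearls among $x$ and the pearls separated from the root by $x$; the excess of the tree is that of its root. The tree is non-negative if all its pearls have non-negative excess. **Rewiring.** Follow the contour of a non-negative $\mathcal Q$-tree $\tau$ clockwise. The walk meets each $\blacklozenge$-pearl just before following its red edge away from that pearl (its left corner), and meets each $\blacktriangle$-pearl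 once. Iteratively match each unmatched $\blacklozenge$ whose next unmatched $\blacklozenge$ or $\blacktriangle$ on this cyclic walk is a $\blacktriangle$ with that $\blacktriangle$, adding a blue edge between them; stop when no such pair remains. The rewiring $\phi(\tau)$ is obtained by then deleting the red edges; necklaces and root are kept. **Companion trees.** A $\square$-rooted $\mathcal Q$-companion tree is a tree with black and blue edges, rooted at a free $\square$-pearl, in which each $\bullet$- and each $\blacklozenge$-pearl is incident to exactly one edge and each $\square$- and each $\blacktriangle$-pearl to at most one edge. Its defects are its free $\blacktriangle$-pearls. Follow its contour counterclockwise, meeting each $\blacklozenge$-pearl just before following its blue edge away from that pearl (its right corner), and iteratively match each unmatched $\blacklozenge$ with the next free $\square$ in the same manner, adding red edges; the result is the inverse closure. The tree is balanced if its root is the $\square$-pearl left unmatched. A defect is internal if it lies in a bounded face of the inverse closure, that is, if it is met strictly between the two ends of some added red edge on the counterclockwise walk from its $\blacklozenge$ to its $\square$; otherwise it is external. The inverse rewiring $\bar\phi$ of a balanced tree is its inverse closure with the blue edges deleted; necklaces and root are kept. **Theorem.** For every $k\ge 0$, rewiring $\phi$ and inverse rewiring $\bar\phi$ are well defined and mutually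 inverse bijections between * the class $\mathcal F_k$ of non-negative $\mathcal Q$-trees with excess $k$, and * the class $\mathbf B_k$ of balanced $\square$-rooted $\mathcal Q$-companion trees with exactly $k$ external defects and no internal defect, and they preserve the multiset of necklaces. -/

import Mathlib

namespace Rewiring

/-! ### Necklaces and pearls -/

/-- The letters of necklace words: the bullet, the (red) diamond and the (blue) triangle. -/
inductive Letter
  | bullet
  | diamond
  | triangle

/-- The kinds of pearls on a necklace. -/
inductive Kind
  | square
  | bullet
  | diamond
  | triangle

/-- The kind of pearl named by a letter. -/
def Letter.kind : Letter → Kind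
  | .bullet => .bullet
  | .diamond => .diamond
  | .triangle => .triangle

/-- The pearls of a family of necklaces `word v`. Read clockwise, the necklace at `v` carries its
square pearl, at position `0`, followed by its letters, at positions `1, 2, …`. -/
abbrev Pearl {V : Type*} (word : V → List Letter) : Type _ :=
  Σ v : V, Fin ((word v).length + 1)

/-- The kind of a pearl. -/
def Pearl.kind {V : Type*} {word : V → List Letter} (x : Pearl word) : Kind :=
  Fin.cases Kind.square (fun i => ((word x.1).get i).kind) x.2

/-- The clockwise successor of a pearl on its (cyclic) necklace. -/
def Pearl.succ {V : Type*} {word : V → List Letter} (x : Pearl word) : Pearl word :=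
  ⟨x.1, x.2 + 1⟩

/-- The counterclockwise successor of a pearl on its (cyclic) necklace. -/
def Pearl.pred {V : Type*} {word : V → List Letter} (x : Pearl word) : Pearl word :=
  ⟨x.1, x.2 - 1⟩

/-! ### Rooted plane graphs whose vertices are necklaces -/

/-- A pearl-rooted plane graph whose vertices are necklaces and whose edges join pearls.
`edge x y` says that an edge joins `x` to `y`; edges are written from their bullet or diamond end
to their square or triangle end. The edges `bullet → square` are the black ones,
`diamond → square` the red ones and `diamond → triangle` the blue ones. The cyclic order of the
pearls on the necklaces is the rotation system that embeds the graph in the plane. -/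
structure PearlGraph (V : Type*) where
  word : V → List Letter
  edge : Pearl word → Pearl word → Prop
  root : Pearl word

namespace PearlGraph

variable {V : Type*}

/-- `x` and `y` are the two ends of an edge. -/
def Joined (m : PearlGraph V) (x y : Pearl m.word) : Prop :=
  m.edge x y ∨ m.edge y x

/-- A free pearl is incident to no edge. -/
def IsFree (m : PearlGraph V) (x : Pearl m.word) : Prop :=
  ∀ y, ¬ m.Joined x y

/-- The pearl `x` is incident to exactly one edge. -/
def IncidentToOneEdge (m : PearlGraph V) (x : Pearl m.word) : Prop :=
  ∃! e : Pearl m.word × Pearl m.word, m.edge e.1 e.2 ∧ (x = e.1 ∨ x = e.2)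

/-- The pearl `x` is incident to at most one edge. -/
def IncidentToAtMostOneEdge (m : PearlGraph V) (x : Pearl m.word) : Prop :=
  ∀ e e' : Pearl m.word × Pearl m.word,
    m.edge e.1 e.2 ∧ (x = e.1 ∨ x = e.2) → m.edge e'.1 e'.2 ∧ (x = e'.1 ∨ x = e'.2) → e = e'

/-- The incidences from which `skeleton` is built. -/
def skeletonRel (m : PearlGraph V) : V ⊕ Pearl m.word → V ⊕ Pearl m.word → Prop
  | .inl v, .inr x => x.1 = v
  | .inr x, .inr y => m.edge x y
  | _, _ => False

/-- The graph on vertices and pearls in which each pearl is attached to the vertex that carries it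
and in which pearls are joined as prescribed by the edges. A loop or a multiple edge between
vertices of `m` gives a cycle here. -/
def skeleton (m : PearlGraph V) : SimpleGraph (V ⊕ Pearl m.word) :=
  SimpleGraph.fromRel m.skeletonRel

/-- The graph is a tree: connected and without cycle. -/
def IsTree (m : PearlGraph V) : Prop :=
  m.skeleton.IsTree

/-! ### Non-negative trees -/

/-- Rooted `Q`-trees. -/
structure IsQTree (Q : Set (List Letter)) (m : PearlGraph V) : Prop where
  word_mem : ∀ v, m.word v ∈ Q
  edge_kind : ∀ x y, m.edge x y → (x.kind = .bullet ∨ x.kind = .diamond) ∧ y.kind = .square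
  root_kind : m.root.kind = .square
  root_free : m.IsFree m.root
  triangle_free : ∀ x : Pearl m.word, x.kind = .triangle → m.IsFree x
  incident : ∀ x : Pearl m.word, x ≠ m.root → x.kind ≠ .triangle → m.IncidentToOneEdge x
  isTree : m.IsTree

/-- The pearls of the subtree at the pearl `x`: the pearl `x` and those on the other side of `x`
with respect to the root, that is, the pearls that cannot be reached from the root without going
through `x`. -/
def subtree (m : PearlGraph V) (x : Pearl m.word) : Set (Pearl m.word) :=
  {z | ∀ p : m.skeleton.Walk (.inr m.root) (.inr z), .inr x ∈ p.support}

/-- The excess at a pearl: triangles minus diamonds in its subtree. -/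
noncomputable def excessAt (m : PearlGraph V) (x : Pearl m.word) : ℤ :=
  ({z ∈ m.subtree x | z.kind = .triangle}.ncard : ℤ) -
    ({z ∈ m.subtree x | z.kind = .diamond}.ncard : ℤ)

/-- The excess of a rooted tree, that is, of its root. -/
noncomputable def excess (m : PearlGraph V) : ℤ := m.excessAt m.root

/-- Non-negative `Q`-trees: the excess is non-negative at each pearl. -/
structure IsNonnegQTree (Q : Set (List Letter)) (m : PearlGraph V) : Prop extends
    IsQTree Q m where
  nonneg : ∀ x, 0 ≤ m.excessAt x

/-! ### Walking around a tree, and matching half-edges -/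

open Classical in
/-- The other end of the edge at `x`, or `x` itself if `x` is free (used on graphs in which each
pearl is incident to at most one edge). -/
noncomputable def mate (m : PearlGraph V) (x : Pearl m.word) : Pearl m.word :=
  if h : ∃ y, m.Joined x y then h.choose else x

/-- One step of the clockwise walk around the graph. The walk reaches a pearl `x` on the
counterclockwise side of its edge (the left corner at `x`). It then follows this edge, if there is
one, and goes on clockwise around the necklace that it has reached. -/
noncomputable def cwStep (m : PearlGraph V) (x : Pearl m.word) : Pearl m.word :=
  (m.mate x).succ

/-- One step of the counterclockwise walk around the graph. The walk reaches a pearl `x` on the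
clockwise side of its edge (the right corner at `x`). It then follows this edge, if there is
one, and goes on counterclockwise around the necklace that it has reached. -/
noncomputable def ccwStep (m : PearlGraph V) (x : Pearl m.word) : Pearl m.word :=
  (m.mate x).pred

end PearlGraph

/-- The corners that carry a half-edge not yet matched by `M`, when outgoing and incoming
half-edges have been grown in the corners of `out` and `inc`. -/
def unmatched {P : Type*} (out inc : Set P) (M : Set (P × P)) : Set P :=
  {z | z ∈ out ∪ inc ∧ ∀ e ∈ M, z ≠ e.1 ∧ z ≠ e.2}

/-- The matching pairs of the current stage: an unmatched outgoing half-edge and an unmatched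
incoming one such that the walk `step` meets no other unmatched half-edge from the first to the
second. -/
def matchingPairs {P : Type*} (step : P → P) (out inc : Set P) (M : Set (P × P)) : Set (P × P) :=
  {e | e.1 ∈ out ∧ e.1 ∈ unmatched out inc M ∧ e.2 ∈ inc ∧ e.2 ∈ unmatched out inc M ∧
    ∃ j, 0 < j ∧ step^[j] e.1 = e.2 ∧
      ∀ i, 0 < i → i < j → step^[i] e.1 ∉ unmatched out inc M}

/-- The pairs obtained by matching iteratively all matching pairs until none is left. -/
def closurePairs {P : Type*} (step : P → P) (out inc : Set P) : Set (P × P) :=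
  ⋃ n : ℕ, (fun M => M ∪ matchingPairs step out inc M)^[n] ∅

/-- The corner `z` is met strictly between `x` and `y` on the walk `step` from `x` to `y`: an edge
drawn along this walk from `x` to `y` encloses `z`, in the sense that `z` lies inside the simple
cycle which that edge forms with the tree. -/
def Encloses {P : Type*} (step : P → P) (x y z : P) : Prop :=
  ∃ j, step^[j] x = y ∧ (∀ i, 0 < i → i < j → step^[i] x ≠ y) ∧
    ∃ i, 0 < i ∧ i < j ∧ step^[i] x = z

namespace PearlGraph

variable {V : Type*}

/-- Deletion of the red edges. -/
def deleteRed (m : PearlGraph V) : PearlGraph V where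
  word := m.word
  edge x y := m.edge x y ∧ ¬ (x.kind = .diamond ∧ y.kind = .square)
  root := m.root

/-- Deletion of the blue edges. -/
def deleteBlue (m : PearlGraph V) : PearlGraph V where
  word := m.word
  edge x y := m.edge x y ∧ ¬ (x.kind = .diamond ∧ y.kind = .triangle)
  root := m.root

/-! ### Closure and rewiring -/

/-- The blue edges of the clockwise closure, from left diamond corners to triangle corners. -/
def blueEdges (m : PearlGraph V) : Set (Pearl m.word × Pearl m.word) :=
  closurePairs m.cwStep {x | x.kind = .diamond} {y | y.kind = .triangle}

/-- The (diamond-to-triangle clockwise) closure. -/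
def closure (m : PearlGraph V) : PearlGraph V where
  word := m.word
  edge x y := m.edge x y ∨ (x, y) ∈ m.blueEdges
  root := m.root

/-- Rewiring: closure followed by deletion of the red edges. -/
def rewire (m : PearlGraph V) : PearlGraph V := m.closure.deleteRed

/-! ### Companion trees, inverse closure and inverse rewiring -/

/-- Rooted `Q`-companion trees (rooted on a pearl of any kind). -/
structure IsCompanionTree (Q : Set (List Letter)) (m : PearlGraph V) : Prop where
  word_mem : ∀ v, m.word v ∈ Q
  edge_kind : ∀ x y, m.edge x y →
    (x.kind = .bullet ∧ y.kind = .square) ∨ (x.kind = .diamond ∧ y.kind = .triangle)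
  root_free : m.IsFree m.root
  incident : ∀ x : Pearl m.word, x ≠ m.root → x.kind = .bullet ∨ x.kind = .diamond →
    m.IncidentToOneEdge x
  incident_le : ∀ x : Pearl m.word, x.kind = .square ∨ x.kind = .triangle →
    m.IncidentToAtMostOneEdge x
  isTree : m.IsTree

/-- The red edges of the inverse closure, from right diamond corners to the corners of the free
square pearls. -/
def redEdges (m : PearlGraph V) : Set (Pearl m.word × Pearl m.word) :=
  closurePairs m.ccwStep {x | x.kind = .diamond} {y | y.kind = .square ∧ m.IsFree y}

/-- The inverse (diamond-to-square counterclockwise) closure. -/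
def invClosure (m : PearlGraph V) : PearlGraph V where
  word := m.word
  edge x y := m.edge x y ∨ (x, y) ∈ m.redEdges
  root := m.root

/-- Inverse rewiring: inverse closure followed by deletion of the blue edges. -/
def invRewire (m : PearlGraph V) : PearlGraph V := m.invClosure.deleteBlue

/-- A square-rooted companion tree is balanced if its root is the square pearl that remains
unmatched in its inverse closure. -/
def IsBalanced (m : PearlGraph V) : Prop :=
  m.root.kind = .square ∧ ∀ x, (x, m.root) ∉ m.redEdges

/-- Defects: the free triangle pearls other than the root. -/
def defects (m : PearlGraph V) : Set (Pearl m.word) :=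
  {z | z.kind = .triangle ∧ z ≠ m.root ∧ m.IsFree z}

/-- Internal defects: those in an inner face of the inverse closure, that is, enclosed by a red
edge. -/
def internalDefects (m : PearlGraph V) : Set (Pearl m.word) :=
  {z ∈ m.defects | ∃ e ∈ m.redEdges, Encloses m.ccwStep e.1 e.2 z}

/-- External defects: those in the unbounded face of the inverse closure. -/
def externalDefects (m : PearlGraph V) : Set (Pearl m.word) :=
  m.defects \ m.internalDefects

/-- Balanced square-rooted `Q`-companion trees with `k` external defects and no internal defect. -/
structure IsBalancedCompanionTree (Q : Set (List Letter)) (k : ℕ) (m : PearlGraph V) : Prop extends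
    IsCompanionTree Q m where
  balanced : m.IsBalanced
  external : m.externalDefects.ncard = k
  internal : m.internalDefects = ∅

/-! ### Isomorphism classes -/

/-- Isomorphisms of pearl-rooted plane graphs: they preserve the necklaces with their cyclic
order, the edges and the root. -/
structure Iso {V W : Type*} (m : PearlGraph V) (m' : PearlGraph W) where
  onVertices : V ≃ W
  onPearls : Pearl m.word ≃ Pearl m'.word
  word_eq : ∀ v, m'.word (onVertices v) = m.word v
  vertex_eq : ∀ x, (onPearls x).1 = onVertices x.1
  position_eq : ∀ x, ((onPearls x).2 : ℕ) = (x.2 : ℕ)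
  edge_iff : ∀ x y, m'.edge (onPearls x) (onPearls y) ↔ m.edge x y
  root_eq : onPearls m.root = m'.root

/-- The identity isomorphism. -/
def Iso.refl {V : Type*} (m : PearlGraph V) : Iso m m where
  onVertices := Equiv.refl V
  onPearls := Equiv.refl _
  word_eq _ := rfl
  vertex_eq _ := rfl
  position_eq _ := rfl
  edge_iff _ _ := Iff.rfl
  root_eq := rfl

/-- The inverse isomorphism. -/
def Iso.symm {V W : Type*} {m : PearlGraph V} {m' : PearlGraph W} (f : Iso m m') : Iso m' m where
  onVertices := f.onVertices.symm
  onPearls := f.onPearls.symm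
  word_eq w := by
    have h := f.word_eq (f.onVertices.symm w)
    rw [Equiv.apply_symm_apply] at h
    exact h.symm
  vertex_eq x := by
    have h := f.vertex_eq (f.onPearls.symm x)
    rw [Equiv.apply_symm_apply] at h
    rw [h, Equiv.symm_apply_apply]
  position_eq x := by
    have h := f.position_eq (f.onPearls.symm x)
    rw [Equiv.apply_symm_apply] at h
    exact h.symm
  edge_iff x y := by
    have h := f.edge_iff (f.onPearls.symm x) (f.onPearls.symm y)
    rw [Equiv.apply_symm_apply, Equiv.apply_symm_apply] at h
    exact h.symm
  root_eq := by rw [← f.root_eq, Equiv.symm_apply_apply]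

/-- The composite of two isomorphisms. -/
def Iso.trans {U V W : Type*} {m : PearlGraph U} {m' : PearlGraph V} {m'' : PearlGraph W}
    (f : Iso m m') (g : Iso m' m'') : Iso m m'' where
  onVertices := f.onVertices.trans g.onVertices
  onPearls := f.onPearls.trans g.onPearls
  word_eq v := (g.word_eq _).trans (f.word_eq v)
  vertex_eq x := (g.vertex_eq _).trans (congrArg g.onVertices (f.vertex_eq x))
  position_eq x := (g.position_eq _).trans (f.position_eq x)
  edge_iff x y := (g.edge_iff _ _).trans (f.edge_iff x y)
  root_eq := (congrArg g.onPearls f.root_eq).trans g.root_eq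

end PearlGraph

/-- Finite pearl-rooted plane graphs, on the vertex sets `Fin n`. -/
abbrev FinPearlGraph : Type := Σ n : ℕ, PearlGraph (Fin n)

/-- Finite pearl-rooted plane graphs up to isomorphism. -/
def pearlGraphSetoid : Setoid FinPearlGraph where
  r m m' := Nonempty (PearlGraph.Iso m.2 m'.2)
  iseqv :=
    { refl := fun m => ⟨PearlGraph.Iso.refl m.2⟩
      symm := fun ⟨f⟩ => ⟨f.symm⟩
      trans := fun ⟨f⟩ ⟨g⟩ => ⟨f.trans g⟩ }

/-- Unlabelled finite pearl-rooted plane graphs. -/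
abbrev PearlGraphClass : Type := Quotient pearlGraphSetoid

/-- The isomorphism class of a graph. -/
def PearlGraph.toClass {n : ℕ} (m : PearlGraph (Fin n)) : PearlGraphClass :=
  Quotient.mk pearlGraphSetoid ⟨n, m⟩

/-- The multiset of the necklaces of a graph. -/
def necklaces : PearlGraphClass → Multiset (List Letter) :=
  Quotient.lift (fun m : FinPearlGraph => (Finset.univ : Finset (Fin m.1)).val.map m.2.word) (by
    rintro ⟨n, m⟩ ⟨n', m'⟩ ⟨f⟩
    have h : m.word = m'.word ∘ f.onVertices := funext fun v => (f.word_eq v).symm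
    change Multiset.map m.word _ = Multiset.map m'.word _
    rw [h, ← Multiset.map_map, ← Finset.map_univ_equiv f.onVertices]
    rfl)

/-- The class of the non-negative `Q`-trees with excess `k`. -/
def nonnegQTrees (Q : Set (List Letter)) (k : ℕ) : Set PearlGraphClass :=
  {c | ∃ (n : ℕ) (m : PearlGraph (Fin n)), m.IsNonnegQTree Q ∧ m.excess = k ∧ m.toClass = c}

/-- The class of the balanced square-rooted `Q`-companion trees with `k` external defects and no
internal defect. -/
def balancedCompanionTrees (Q : Set (List Letter)) (k : ℕ) : Set PearlGraphClass :=
  {c | ∃ (n : ℕ) (m : PearlGraph (Fin n)), m.IsBalancedCompanionTree Q k ∧ m.toClass = c}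

end Rewiring

/-! Rewiring exchanges two matchings of the diamonds: each diamond is joined to a square on one side
(red edges) and to a triangle on the other (blue edges), while the black edges stay. Call the edges
to be deleted chords and the edges to be added arcs. If `ρ` is the contour walk of the original
tree, and `mc`, `ma` are the mates before and after, then the contour walk of the new graph in the
opposite direction is `ρ' = mc ∘ ρ⁻¹ ∘ ma`. Thus the new contour runs backwards along the old one,
jumps over arcs, and makes a detour at each end of a chord. By well-founded induction on the
detours, each chord spans a properly parenthesized stretch of the new contour
(`exists_nestedWalk_exchange`). A properly parenthesized matching is the one found by iterated
matching (`closurePairs_eq_graph`), so the opposite closure restores the chords, and the two maps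
are mutually inverse. The same stretches show that the new graph is connected; since the number of
edges is unchanged, it is a tree.

The arcs themselves come from heights: openers weigh `1`, closers weigh `-1`, and an opener is
closed when the sum along the walk first returns to zero. In a tree each edge is a bridge whose
contour tour visits exactly its far side (`IsFarSide.walkSum_eq`), so the sum over a tour is a
count. In a non-negative tree, the sum over the tour of a diamond is minus its excess. In a
companion tree, bullets pair off with non-free squares, so each far side of a diamond has one more
free square than diamonds and the sum is zero. In both cases the arc closes within the tour of its
own diamond.

The induction on detours is on arc length for `Q`-trees, where the root lies in no far side of an
owner. In a companion tree the root may lie across a blue edge; there the induction uses a height in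
which the root is neutral, with ties broken by position from the root.

Non-negativity after inverse rewiring holds because the former triangle of each diamond lies in its
subtree, which injects the diamonds of every subtree into its triangles. The absence of internal
defects says that all triangles passed under a red edge are matched. The remaining triangles are
then the external defects, whose number is triangles minus diamonds, the excess. -/

namespace Rewiring

/-! ### Properly parenthesized walks -/

/-- The walk of `n` steps from `z` reads a properly parenthesized word: the corners of `out` open,
the corner `f x` closes what `x` opened, and all other corners are in `N`. -/
inductive NestedWalk {P : Type*} (step : P → P) (N out : Set P) (f : P → P) : P → ℕ → Prop
  | nil (z : P) : NestedWalk step N out f z 0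
  | skip {z : P} {n : ℕ} (hz : z ∈ N) (h : NestedWalk step N out f (step z) n) :
      NestedWalk step N out f z (n + 1)
  | arc {x : P} {n m : ℕ} (hx : x ∈ out) (h : NestedWalk step N out f (step x) n)
      (hf : step^[n + 1] x = f x) (h' : NestedWalk step N out f (step (f x)) m) :
      NestedWalk step N out f x (n + m + 2)

namespace NestedWalk

variable {P : Type*} {step : P → P} {N N' out inc : Set P} {f : P → P}

theorem mono (hN : N ⊆ N') {z : P} {n : ℕ} (h : NestedWalk step N out f z n) :
    NestedWalk step N' out f z n := by
  induction h with
  | nil z => exact .nil z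
  | skip hz _ ih => exact .skip (hN hz) ih
  | arc hx _ hf _ ih ih' => exact .arc hx ih hf ih'

theorem append {z : P} {n m : ℕ} (h : NestedWalk step N out f z n)
    (h' : NestedWalk step N out f (step^[n] z) m) : NestedWalk step N out f z (n + m) := by
  induction h with
  | nil z => simpa using h'
  | @skip z n hz _ ih =>
    rw [show n + 1 + m = (n + m) + 1 by ring]
    exact .skip hz (ih h')
  | @arc x n k hx h₁ hf h₂ ih ih' =>
    rw [show n + k + 2 + m = n + (k + m) + 2 by ring]
    refine .arc hx h₁ hf (ih' ?_)
    rw [show n + k + 2 = k + 1 + (n + 1) by ring, Function.iterate_add_apply, hf] at h'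
    exact h'

theorem iterate_mem {z : P} {n : ℕ} (h : NestedWalk step N out f z n) :
    ∀ i < n, step^[i] z ∈ N ∨ step^[i] z ∈ out ∨ ∃ x ∈ out, step^[i] z = f x := by
  induction h with
  | nil z => intro i hi; omega
  | @skip z n hz _ ih =>
    rintro (_ | i) hi
    · exact .inl hz
    · exact ih i (by omega)
  | @arc x n k hx h₁ hf h₂ ih ih' =>
    rintro (_ | i) hi
    · exact .inr (.inl hx)
    · rcases lt_trichotomy i n with h | h | h
      · exact ih i h
      · subst h; exact .inr (.inr ⟨x, hx, hf⟩)
      · obtain ⟨j, rfl⟩ := Nat.exists_eq_add_of_lt h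
        have := ih' j (by omega)
        rw [show n + j + 1 + 1 = j + 1 + (n + 1) by ring, Function.iterate_add_apply, hf]
        exact this

/-- In a partial matching along `f`, the first unmatched corner of a properly parenthesized walk is
not incoming. -/
theorem not_first_unmatched (hio : Disjoint out inc) (hN : Disjoint N inc) {M : Set (P × P)}
    (hfi : ∀ x ∈ out, f x ∈ inc)
    (hM : ∀ e ∈ M, e.1 ∈ out ∧ e.2 = f e.1) {z : P} {n : ℕ} (h : NestedWalk step N out f z n) :
    ∀ j < n, step^[j] z ∈ inc → step^[j] z ∈ unmatched out inc M →
      ∃ i < j, step^[i] z ∈ unmatched out inc M := by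
  induction h with
  | nil z => intro i hi; omega
  | @skip z n hz _ ih =>
    rintro (_ | j) hj h1 h2
    · exact (Set.disjoint_left.1 hN hz h1).elim
    · obtain ⟨i, hi, h3⟩ := ih j (by omega) h1 h2
      exact ⟨i + 1, by omega, h3⟩
  | @arc x n k hx h₁ hf h₂ ih ih' =>
    rintro (_ | j) hj h1 h2
    · exact (Set.disjoint_left.1 hio hx h1).elim
    by_cases hxu : x ∈ unmatched out inc M
    · exact ⟨0, by omega, hxu⟩
    -- As `M` lies on the graph of `f`, the two ends of an arc are matched together or not at all.
    have hxM : (x, f x) ∈ M := by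
      by_contra hc
      refine hxu ⟨.inl hx, fun e he => ?_⟩
      obtain ⟨h3, h4⟩ := hM e he
      constructor
      · rintro rfl
        apply hc
        rw [← h4]
        exact he
      · rintro rfl
        rw [h4] at hx
        exact Set.disjoint_left.1 hio hx (hfi _ h3)
    rcases lt_trichotomy j n with h | h | h
    · obtain ⟨i, hi, h3⟩ := ih j h h1 h2
      exact ⟨i + 1, by omega, h3⟩
    · subst h
      rw [hf] at h2
      exact ((h2.2 _ hxM).2 rfl).elim
    · obtain ⟨l, rfl⟩ := Nat.exists_eq_add_of_lt h
      have e : ∀ l, step^[n + l + 1 + 1] x = step^[l] (step (f x)) := fun l => by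
        rw [show n + l + 1 + 1 = l + 1 + (n + 1) by ring, Function.iterate_add_apply, hf]
        rfl
      rw [e] at h1 h2
      obtain ⟨i, hi, h3⟩ := ih' l (by omega) h1 h2
      exact ⟨n + i + 1 + 1, by omega, by rw [e]; exact h3⟩

end NestedWalk

/-! ### Iterated matching finds the nested matching. -/

section Closure

variable {P : Type*} {step : P → P} {N out inc : Set P} {f : P → P}

/-- The pairs matched in the first `n` stages. -/
def stagePairs (step : P → P) (out inc : Set P) (n : ℕ) : Set (P × P) :=
  (fun M => M ∪ matchingPairs step out inc M)^[n] ∅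

theorem stagePairs_succ (n : ℕ) : stagePairs step out inc (n + 1) =
    stagePairs step out inc n ∪ matchingPairs step out inc (stagePairs step out inc n) := by
  rw [stagePairs, Function.iterate_succ_apply']
  rfl

theorem stagePairs_mono : Monotone (stagePairs step out inc) :=
  monotone_nat_of_le_succ fun n => by
    rw [stagePairs_succ]
    exact Set.subset_union_left

theorem mem_closurePairs {e : P × P} :
    e ∈ closurePairs step out inc ↔ ∃ n, e ∈ stagePairs step out inc n := Set.mem_iUnion

/-- A matching pair starting at `x` cannot end inside the arc of `x`, where an unmatched closer is
preceded by another unmatched half-edge (`not_first_unmatched`). Nor can it end beyond `f x`, which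
by injectivity stays unmatched as long as `x` does. -/
theorem stagePairs_subset_graph (hio : Disjoint out inc) (hN : Disjoint N inc)
    (hfi : ∀ x ∈ out, f x ∈ inc) (hinj : Set.InjOn f out)
    (hf : ∀ x ∈ out, ∃ n, NestedWalk step N out f (step x) n ∧ step^[n + 1] x = f x) (n : ℕ) :
    ∀ e ∈ stagePairs step out inc n, e.1 ∈ out ∧ e.2 = f e.1 := by
  induction n with
  | zero => intro e he; exact absurd he (Set.notMem_empty e)
  | succ n ih =>
    intro e he
    rw [stagePairs_succ] at he
    rcases he with he | ⟨h1, h2, h3, h4, j, hj, h5, h6⟩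
    · exact ih e he
    refine ⟨h1, ?_⟩
    obtain ⟨m, hm, hm'⟩ := hf _ h1
    obtain ⟨j, rfl⟩ : ∃ k, j = k + 1 := ⟨j - 1, by omega⟩
    rcases lt_trichotomy j m with h | h | h
    · rw [← h5] at h3 h4
      obtain ⟨i, hi, h7⟩ := hm.not_first_unmatched hio hN hfi ih j h h3 h4
      exact (h6 (i + 1) (by omega) (by omega) h7).elim
    · subst h; exact h5.symm.trans hm'
    · have h7 := h6 (m + 1) (by omega) (by omega)
      rw [hm'] at h7
      refine (h7 ⟨.inr (hfi _ h1), fun e' he' => ?_⟩).elim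
      obtain ⟨h8, h9⟩ := ih e' he'
      constructor
      · intro h10
        exact Set.disjoint_left.1 hio (h10 ▸ h8) (hfi _ h1)
      · intro h10
        rw [h9] at h10
        exact (h2.2 e' he').1 (hinj h1 h8 h10)

/-- The finitely many interior half-edges are all matched by a common stage `K`. From then on `f x`
is the next half-edge after `x`, so the pair is added by stage `K + 1`. -/
theorem mem_closurePairs_of_interior (hio : Disjoint out inc) (hfi : ∀ x ∈ out, f x ∈ inc)
    (hinj : Set.InjOn f out)
    (hg : ∀ n, ∀ e ∈ stagePairs step out inc n, e.1 ∈ out ∧ e.2 = f e.1)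
    {x : P} (hx : x ∈ out) {n : ℕ} (hn : step^[n + 1] x = f x)
    (hi : ∀ i < n, step^[i] (step x) ∈ out ∪ inc →
      ∃ e ∈ closurePairs step out inc, step^[i] (step x) = e.1 ∨ step^[i] (step x) = e.2) :
    (x, f x) ∈ closurePairs step out inc := by
  have hi' : ∀ i < n, ∃ k, step^[i] (step x) ∈ out ∪ inc →
      ∃ e ∈ stagePairs step out inc k, step^[i] (step x) = e.1 ∨ step^[i] (step x) = e.2 := by
    intro i hin
    by_cases h : step^[i] (step x) ∈ out ∪ inc
    · obtain ⟨e, he, h'⟩ := hi i hin h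
      obtain ⟨k, hk⟩ := mem_closurePairs.1 he
      exact ⟨k, fun _ => ⟨e, hk, h'⟩⟩
    · exact ⟨0, fun h' => (h h').elim⟩
  choose! k hk using hi'
  set K := (Finset.range n).sup k
  by_contra hc
  have hu : ∀ z, z = x ∨ z = f x → z ∈ unmatched out inc (stagePairs step out inc K) := by
    intro z hz
    refine ⟨?_, fun e he => ?_⟩
    · rcases hz with rfl | rfl
      exacts [.inl hx, .inr (hfi _ hx)]
    obtain ⟨h1, h2⟩ := hg K e he
    have h3 : e.1 ≠ x := by
      rintro rfl
      exact hc (mem_closurePairs.2 ⟨K, h2 ▸ he⟩)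
    rcases hz with rfl | rfl
    · exact ⟨h3.symm, fun h => Set.disjoint_left.1 hio hx (by rw [h, h2]; exact hfi _ h1)⟩
    · exact ⟨fun h => Set.disjoint_left.1 hio (h ▸ h1) (hfi _ hx),
        fun h => h3 (hinj h1 hx (h2 ▸ h.symm))⟩
  refine hc (mem_closurePairs.2 ⟨K + 1, ?_⟩)
  rw [stagePairs_succ]
  refine .inr ⟨hx, hu _ (.inl rfl), hfi _ hx, hu _ (.inr rfl), n + 1, by omega, hn, ?_⟩
  rintro (_ | i) h0 hin h
  · omega
  · obtain ⟨e, he, h'⟩ := hk i (by omega) h.1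
    have := h.2 e (stagePairs_mono (Finset.le_sup (f := k) (Finset.mem_range.2 (by omega))) he)
    rcases h' with h' | h'
    exacts [this.1 h', this.2 h']

/-- A matching whose arcs are properly parenthesized is the one found by iterated matching. -/
theorem closurePairs_eq_graph (hio : Disjoint out inc) (hNo : Disjoint N out) (hN : Disjoint N inc)
    (hfi : ∀ x ∈ out, f x ∈ inc) (hinj : Set.InjOn f out)
    (hf : ∀ x ∈ out, ∃ n, NestedWalk step N out f (step x) n ∧ step^[n + 1] x = f x) :
    closurePairs step out inc = {e | e.1 ∈ out ∧ e.2 = f e.1} := by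
  have hg := stagePairs_subset_graph hio hN hfi hinj hf
  -- Induction on the parenthesized word: inner arcs are matched before the arc that contains them.
  have key : ∀ z n, NestedWalk step N out f z n → ∀ i < n, step^[i] z ∈ out ∪ inc →
      ∃ e ∈ closurePairs step out inc, step^[i] z = e.1 ∨ step^[i] z = e.2 := by
    intro z n h
    induction h with
    | nil z => intro i hi; omega
    | @skip z n hz _ ih =>
      rintro (_ | i) hi h
      · rcases h with h | h
        exacts [(Set.disjoint_left.1 hNo hz h).elim, (Set.disjoint_left.1 hN hz h).elim]
      · exact ih i (by omega) h
    | @arc x n k hx h₁ hf h₂ ih ih' =>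
      have hm := mem_closurePairs_of_interior hio hfi hinj hg hx hf ih
      rintro (_ | i) hi h
      · exact ⟨_, hm, .inl rfl⟩
      · rcases lt_trichotomy i n with h' | h' | h'
        · exact ih i h' h
        · subst h'; exact ⟨_, hm, .inr hf⟩
        · obtain ⟨j, rfl⟩ := Nat.exists_eq_add_of_lt h'
          rw [show n + j + 1 + 1 = j + 1 + (n + 1) by ring, Function.iterate_add_apply, hf] at h ⊢
          exact ih' j (by omega) h
  ext ⟨x, y⟩
  constructor
  · intro h
    obtain ⟨n, hn⟩ := mem_closurePairs.1 h
    exact hg n _ hn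
  · rintro ⟨hx, hy⟩
    obtain rfl : y = f x := hy
    obtain ⟨n, h1, h2⟩ := hf x hx
    exact mem_closurePairs_of_interior hio hfi hinj hg hx h2 (key _ _ h1)

end Closure

/-! ### Heights -/

section Height

variable {P : Type*} (step : P → P) (wt : P → ℤ)

/-- The total weight of the first `n` corners of the walk from `z`. -/
def walkSum (z : P) (n : ℕ) : ℤ := ∑ i ∈ Finset.range n, wt (step^[i] z)

theorem walkSum_zero (z : P) : walkSum step wt z 0 = 0 := by simp [walkSum]

theorem walkSum_succ (z : P) (n : ℕ) :
    walkSum step wt z (n + 1) = walkSum step wt z n + wt (step^[n] z) := by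
  simp [walkSum, Finset.sum_range_succ]

theorem walkSum_one (z : P) : walkSum step wt z 1 = wt z := by simp [walkSum]

theorem walkSum_add (z : P) (n m : ℕ) :
    walkSum step wt z (n + m) = walkSum step wt z n + walkSum step wt (step^[n] z) m := by
  rw [walkSum, Finset.sum_range_add]
  simp only [walkSum, ← Function.iterate_add_apply, add_comm]

/-- The time at which the walk from `x` closes what `x` opens. -/
noncomputable def closingTime (x : P) : ℕ := sInf {T | walkSum step wt x (T + 1) ≤ 0}

/-- The corner at which the walk from `x` closes what `x` opens. -/
noncomputable def closingCorner (x : P) : P := step^[closingTime step wt x] x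

variable {step wt} {out inc N : Set P}

theorem closingTime_le {x : P} {T : ℕ} (h : walkSum step wt x (T + 1) ≤ 0) :
    closingTime step wt x ≤ T := Nat.sInf_le h

theorem walkSum_pos_of_le_closingTime {x : P} {i : ℕ} (hi : 0 < i)
    (h : i ≤ closingTime step wt x) : 0 < walkSum step wt x i := by
  obtain ⟨j, rfl⟩ : ∃ k, i = k + 1 := ⟨i - 1, by omega⟩
  by_contra hc
  have := closingTime_le (not_lt.1 hc)
  omega

/-- The weights of outgoing, incoming and neutral corners. -/
structure IsWeight (wt : P → ℤ) (out inc N : Set P) : Prop where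
  mem : ∀ z, z ∈ out ∨ z ∈ inc ∨ z ∈ N
  out : ∀ z ∈ out, wt z = 1
  inc : ∀ z ∈ inc, wt z = -1
  neutral : ∀ z ∈ N, wt z = 0

variable (hw : IsWeight wt out inc N)
  (hT : ∀ x ∈ out, ∃ T, walkSum step wt x (T + 1) ≤ 0)

include hw in
theorem IsWeight.neg_one_le (z : P) : -1 ≤ wt z := by
  rcases hw.mem z with h | h | h
  · rw [hw.out z h]; norm_num
  · rw [hw.inc z h]
  · rw [hw.neutral z h]; norm_num

include hw hT

theorem closingTime_pos {x : P} (hx : x ∈ out) : 0 < closingTime step wt x := by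
  rcases Nat.eq_zero_or_pos (closingTime step wt x) with h | h
  · have : walkSum step wt x (closingTime step wt x + 1) ≤ 0 := Nat.sInf_mem (hT x hx)
    rw [h, zero_add, walkSum_one, hw.out x hx] at this
    norm_num at this
  · exact h

/-- Weights are at least `-1`, so the sum cannot jump over zero. The `T + 1` in `closingTime` counts
the closing corner itself, and `hT` excludes the default value `sInf ∅ = 0`. -/
theorem walkSum_closingTime {x : P} (hx : x ∈ out) :
    walkSum step wt x (closingTime step wt x) = 1 ∧ wt (closingCorner step wt x) = -1 := by
  have h1 : walkSum step wt x (closingTime step wt x + 1) ≤ 0 := Nat.sInf_mem (hT x hx)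
  have h2 := walkSum_pos_of_le_closingTime (closingTime_pos hw hT hx) le_rfl
  have h3 := hw.neg_one_le (closingCorner step wt x)
  rw [walkSum_succ] at h1
  change _ + wt (closingCorner step wt x) ≤ 0 at h1
  constructor <;> omega

theorem closingCorner_mem {x : P} (hx : x ∈ out) : closingCorner step wt x ∈ inc := by
  have h := (walkSum_closingTime hw hT hx).2
  rcases hw.mem (closingCorner step wt x) with h' | h' | h'
  · rw [hw.out _ h'] at h; norm_num at h
  · exact h'
  · rw [hw.neutral _ h'] at h; norm_num at h

/-- Arcs are strictly nested: the sum is positive at time `i` and zero just after the closing corner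
of `x`, so the stretch in between has negative sum and what opens at time `i` is closed strictly
earlier. -/
theorem add_closingTime_lt {x : P} (hx : x ∈ out) {i : ℕ} (hi : 0 < i)
    (hi' : i < closingTime step wt x) (ho : step^[i] x ∈ out) :
    i + closingTime step wt (step^[i] x) < closingTime step wt x := by
  have h1 := walkSum_pos_of_le_closingTime hi hi'.le
  have h2 := (walkSum_closingTime hw hT hx).1
  have h3 := (walkSum_closingTime hw hT hx).2
  obtain ⟨t, ht⟩ := Nat.exists_eq_add_of_le hi'.le
  have h4 : walkSum step wt (step^[i] x) (t + 1) < 0 := by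
    have := walkSum_add step wt x i (t + 1)
    rw [← add_assoc, ← ht, walkSum_succ, h2] at this
    change 1 + wt (closingCorner step wt x) = _ at this
    omega
  have h5 := closingTime_le h4.le
  rcases h5.lt_or_eq with h | h
  · omega
  · have h6 := walkSum_closingTime hw hT ho
    rw [← h, walkSum_succ] at h4
    change _ + wt (closingCorner step wt (step^[i] x)) < 0 at h4
    omega

/-- Of two arcs with the same end, the shorter starts on the longer because `step` is injective;
this contradicts strict nesting. -/
theorem closingCorner_injOn (hs : Function.Injective step) :
    Set.InjOn (closingCorner step wt) out := by
  have key : ∀ x ∈ out, ∀ y ∈ out, closingCorner step wt x = closingCorner step wt y →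
      closingTime step wt x ≤ closingTime step wt y → x = y := by
    intro x hx y hy h hle
    obtain ⟨i, hi⟩ := Nat.exists_eq_add_of_le' hle
    have h1 : x = step^[i] y := by
      apply hs.iterate (closingTime step wt x)
      rw [← Function.iterate_add_apply, add_comm, ← hi]
      exact h
    rcases Nat.eq_zero_or_pos i with rfl | h0
    · exact h1
    · have h2 := closingTime_pos hw hT hx
      have := add_closingTime_lt hw hT hy h0 (by omega) (h1 ▸ hx)
      rw [← h1] at this
      omega
  intro x hx y hy h
  rcases le_total (closingTime step wt x) (closingTime step wt y) with h' | h'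
  · exact key x hx y hy h h'
  · exact (key y hy x hx h.symm h').symm

/-- First-return decomposition: a path that stays non-negative and ends at zero starts with a
neutral corner, or splits at its first return into an arc over such a path followed by another such
path. -/
theorem nestedWalk_of_walkSum (n : ℕ) : ∀ z, (∀ i ≤ n, 0 ≤ walkSum step wt z i) →
    walkSum step wt z n = 0 → NestedWalk step N out (closingCorner step wt) z n := by
  induction n using Nat.strong_induction_on with
  | _ n ih =>
    intro z h0 hn
    rcases n with _ | n
    · exact .nil z
    have hadd : ∀ i, walkSum step wt z (i + 1) = wt z + walkSum step wt (step z) i := fun i => by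
      rw [add_comm i, walkSum_add, walkSum_one]
      rfl
    rcases hw.mem z with h | h | h
    · have hJ : closingTime step wt z ≤ n := closingTime_le hn.le
      have hJ0 := closingTime_pos hw hT h
      have hJ1 := walkSum_closingTime hw hT h
      obtain ⟨J, hJe⟩ : ∃ J, closingTime step wt z = J + 1 := ⟨_, (Nat.succ_pred_eq_of_pos hJ0).symm⟩
      obtain ⟨m, rfl⟩ := Nat.exists_eq_add_of_le hJ
      have hc : step^[J + 1] z = closingCorner step wt z := by rw [← hJe]; rfl
      have hz := hw.out z h
      rw [show closingTime step wt z + m + 1 = J + m + 2 by omega]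
      refine .arc h (ih J (by omega) _ ?_ ?_) hc (ih m (by omega) _ ?_ ?_)
      · intro i hi
        have := walkSum_pos_of_le_closingTime (step := step) (wt := wt) (x := z) (i := i + 1)
          (by omega) (by omega)
        rw [hadd, hz] at this
        omega
      · have := hadd J
        rw [← hJe] at this
        omega
      all_goals
        have hadd' : ∀ i, walkSum step wt z (closingTime step wt z + 1 + i) =
            walkSum step wt (step (closingCorner step wt z)) i := fun i => by
          rw [walkSum_add, walkSum_succ, Function.iterate_succ_apply']
          change _ + wt (closingCorner step wt z) + walkSum step wt
            (step (closingCorner step wt z)) i = _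
          omega
      · intro i hi
        rw [← hadd']
        exact h0 _ (by omega)
      · rw [← hadd', ← hn]
        congr 1
        omega
    · have := h0 1 (by omega)
      rw [walkSum_one, hw.inc z h] at this
      norm_num at this
    · have hz := hw.neutral z h
      refine .skip h (ih n (by omega) _ (fun i hi => ?_) ?_)
      · have := h0 (i + 1) (by omega)
        rw [hadd, hz] at this
        omega
      · rw [hadd, hz] at hn
        omega

theorem exists_nestedWalk_closingCorner {x : P} (hx : x ∈ out) :
    ∃ n, NestedWalk step N out (closingCorner step wt) (step x) n ∧
      n + 1 = closingTime step wt x ∧ step^[n + 1] x = closingCorner step wt x := by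
  have hJ0 := closingTime_pos hw hT hx
  obtain ⟨J, hJe⟩ : ∃ J, closingTime step wt x = J + 1 := ⟨_, (Nat.succ_pred_eq_of_pos hJ0).symm⟩
  have hadd : ∀ i, walkSum step wt x (i + 1) = wt x + walkSum step wt (step x) i := fun i => by
    rw [add_comm i, walkSum_add, walkSum_one]
    rfl
  have hz := hw.out x hx
  refine ⟨J, nestedWalk_of_walkSum hw hT J _ (fun i hi => ?_) ?_, hJe.symm, ?_⟩
  · have := walkSum_pos_of_le_closingTime (step := step) (wt := wt) (x := x) (i := i + 1)
      (by omega) (by omega)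
    rw [hadd, hz] at this
    omega
  · have := hadd J
    have h1 := (walkSum_closingTime hw hT hx).1
    rw [← hJe] at this
    omega
  · rw [← hJe]; rfl

end Height

/-! ### Exchange of chords and arcs -/

/-- The walk of `n` steps from `z` consists of corners of `L` and of arcs from `x` to `a x` with
`a x ∈ K`. -/
inductive LevelWalk {P : Type*} (step : P → P) (L K D : Set P) (a : P → P) : P → ℕ → Prop
  | nil (z : P) : LevelWalk step L K D a z 0
  | skip {z : P} {n : ℕ} (hz : z ∈ L) (h : LevelWalk step L K D a (step z) n) :
      LevelWalk step L K D a z (n + 1)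
  | arc {x : P} {n m : ℕ} (hx : x ∈ D) (hf : step^[n + 1] x = a x) (hK : a x ∈ K)
      (h : LevelWalk step L K D a (step (a x)) m) :
      LevelWalk step L K D a x (n + m + 2)

section Exchange

variable {P : Type*} {N L K D : Set P} {a c : P → P}

theorem NestedWalk.height_eq {step : P → P} {e : P → ℤ} (hN : ∀ w ∈ N, e (step w) = e w)
    (ha : ∀ x ∈ D, ∀ n, NestedWalk step N D a (step x) n → step^[n + 1] x = a x →
      e (step^[n + 1] x) = e (step x) → e (step (a x)) = e x) {z : P} {n : ℕ}
    (h : NestedWalk step N D a z n) : e (step^[n] z) = e z := by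
  induction h with
  | nil z => rfl
  | skip hz _ ih => exact ih.trans (hN _ hz)
  | @arc x n m hx h₁ hf h₂ ih ih' =>
    rw [show n + m + 2 = m + 1 + (n + 1) by ring, Function.iterate_add_apply, hf]
    exact ih'.trans (ha x hx n h₁ hf ih)

/-- The interiors of the outermost arcs are forgotten. What remains is at the initial height, so
membership in `L` and `K` has to be checked at that height only. -/
theorem NestedWalk.toLevelWalk {step : P → P} {e : P → ℤ} (hN : ∀ w ∈ N, e (step w) = e w)
    (ha : ∀ x ∈ D, ∀ n, NestedWalk step N D a (step x) n → step^[n + 1] x = a x →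
      e (step^[n + 1] x) = e (step x) → e (step (a x)) = e x) {z : P} {n : ℕ}
    (h : NestedWalk step N D a z n)
    (hL : ∀ i < n, step^[i] z ∈ N → e (step^[i] z) = e z → step^[i] z ∈ L)
    (hK : ∀ x ∈ D, e x = e z → a x ∈ K) : LevelWalk step L K D a z n := by
  induction h with
  | nil z => exact .nil z
  | @skip z n hz _ ih =>
    refine .skip (hL 0 (by omega) hz rfl) (ih ?_ ?_)
    · intro i hi h1 h2
      exact hL (i + 1) (by omega) h1 (h2.trans (hN z hz))
    · intro x hx h
      exact hK x hx (h.trans (hN z hz))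
  | @arc x n m hx h₁ hf h₂ ih ih' =>
    have he := ha x hx n h₁ hf (h₁.height_eq hN ha)
    refine .arc hx hf (hK x hx rfl) (ih' ?_ ?_)
    · intro i hi h1 h2
      have : step^[n + i + 2] x = step^[i] (step (a x)) := by
        rw [show n + i + 2 = i + 1 + (n + 1) by ring, Function.iterate_add_apply, hf]
        rfl
      have h3 := hL (n + i + 2) (by omega)
      rw [this] at h3
      exact h3 h1 (h2.trans he)
    · intro y hy h
      exact hK y hy (h.trans he)

/-- If the arcs `a` are properly parenthesized along the walk `ρ` in which the ends of the chords
`c` are mates, then the chords `c` are properly parenthesized along the walk `ρ'` in which the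
ends of the arcs `a` are mates. -/
theorem exists_nestedWalk_exchange (ρ : Equiv.Perm P) {ρ' ma mc : P → P}
    (hρ' : ∀ z, ρ' z = mc (ρ.symm (ma z)))
    (hmc : ∀ x ∈ D, mc x = c x ∧ mc (c x) = x ∧ mc (a x) = a x)
    (hma : ∀ x ∈ D, ma x = a x ∧ ma (a x) = x ∧ ma (c x) = c x)
    {R : P → P → Prop} (hR : WellFounded R) {L N' : P → Set P}
    (hL : ∀ x ∈ D, ∀ w ∈ L x, (∃ y ∈ D, c y = w ∧ R y x ∧ N' y ⊆ N' x) ∨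
      (ma (mc w) = w ∧ mc w ∈ N' x))
    (hlev : ∀ x ∈ D, ∃ n, LevelWalk ρ (L x) (N' x) D a (ρ x) n ∧ ρ^[n + 1] x = a x) :
    ∀ x ∈ D, ∃ t, NestedWalk ρ' (N' x) D c (ρ' x) t ∧ ρ'^[t + 1] x = c x := by
  intro x
  induction x using hR.induction with
  | _ x ih =>
    intro hx
    -- Read backwards and shifted by `mc ∘ ρ⁻¹`, a level walk of `ρ` becomes a parenthesized stretch
    -- of `ρ'`.
    have key : ∀ z n, LevelWalk ρ (L x) (N' x) D a z n →
        ∃ t, NestedWalk ρ' (N' x) D c (mc (ρ.symm (ρ^[n] z))) t ∧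
          ρ'^[t] (mc (ρ.symm (ρ^[n] z))) = mc (ρ.symm z) := by
      intro z n h
      induction h with
      | nil z => exact ⟨0, .nil _, rfl⟩
      | @skip z n hz _ ih' =>
        obtain ⟨t, h1, h2⟩ := ih'
        rw [ρ.symm_apply_apply] at h2
        rw [Function.iterate_succ_apply]
        -- If `z` ends the chord of `y`, the new walk arrives at `y` and makes the detour to `c y`
        -- given by induction; otherwise it passes `mc z` as a neutral corner.
        rcases hL x hx z hz with ⟨y, hy, rfl, hyx, hN⟩ | ⟨h3, h4⟩
        · obtain ⟨s, h5, h6⟩ := ih y hyx hy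
          rw [(hmc y hy).2.1] at h2
          have h7 : ρ' (c y) = mc (ρ.symm (c y)) := by rw [hρ', (hma y hy).2.2]
          refine ⟨t + (s + 0 + 2), h1.append ?_, ?_⟩
          · rw [h2]
            exact .arc hy (h5.mono hN) h6 (.nil _)
          · rw [show t + (s + 0 + 2) = 1 + (s + 1) + t by ring, Function.iterate_add_apply, h2,
              Function.iterate_add_apply, h6]
            exact h7
        · refine ⟨t + 1, h1.append ?_, ?_⟩
          · rw [h2]
            exact .skip h4 (.nil _)
          · rw [add_comm, Function.iterate_add_apply, h2, Function.iterate_one, hρ', h3]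
      -- At `a y` the new walk follows the arc back to `y`: the whole interior of the arc is passed
      -- in one step.
      | @arc y n m hy hf hK _ ih' =>
        obtain ⟨t, h1, h2⟩ := ih'
        rw [ρ.symm_apply_apply, (hmc y hy).2.2] at h2
        rw [show n + m + 2 = m + 1 + (n + 1) by ring, Function.iterate_add_apply, hf]
        refine ⟨t + 1, h1.append ?_, ?_⟩
        · rw [h2]
          exact .skip hK (.nil _)
        · change ρ'^[t + 1] (mc (ρ.symm (ρ^[m] (ρ (a y))))) = _
          rw [Function.iterate_succ_apply', h2, hρ', (hma y hy).2.1]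
    obtain ⟨n, h1, h2⟩ := hlev x hx
    obtain ⟨t, h3, h4⟩ := key _ _ h1
    have h5 : mc (ρ.symm (ρ^[n] (ρ x))) = ρ' x := by
      rw [← Function.iterate_succ_apply, h2, hρ', (hma x hx).1]
    rw [h5] at h3 h4
    refine ⟨t, h3, ?_⟩
    rw [Function.iterate_succ_apply, h4, ρ.symm_apply_apply, (hmc x hx).1]

end Exchange

end Rewiring

namespace Rewiring

/-! ### Walks that follow bridges -/

section FarSide

variable {P : Type*} {step μ : P → P} {s : Equiv.Perm P}

/-- The set `F` is the side of `μ x` when the connection between `x` and its mate `μ x` is cut: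
no other connection, and no move around a vertex, crosses the boundary of `F`. -/
structure IsFarSide (s : Equiv.Perm P) (μ : P → P) (x : P) (F : Set P) : Prop where
  notMem : x ∉ F
  mate_mem : μ x ∈ F
  move_mem : ∀ z, s z ∈ F ↔ z ∈ F
  mate_mem_iff : ∀ z, z ≠ x → z ≠ μ x → (μ z ∈ F ↔ z ∈ F)

variable (hstep : ∀ z, step z = s (μ z)) (hμ : ∀ z, μ (μ z) = z)
  {x : P} {F : Set P} (hF : IsFarSide s μ x F)

include hμ hstep in
theorem step_injective : Function.Injective step := by
  intro z w h
  rw [hstep, hstep] at h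
  rw [← hμ z, s.injective h, hμ]

include hF hstep in
theorem IsFarSide.step_mem_iff {z : P} (h : z ≠ x) (h' : z ≠ μ x) : step z ∈ F ↔ z ∈ F := by
  rw [hstep, hF.move_mem, hF.mate_mem_iff z h h']

include hF hstep in
theorem IsFarSide.eq_of_step_mem {z : P} (h : z ∉ F) (h' : step z ∈ F) : z = x := by
  by_contra hx
  by_cases hy : z = μ x
  · exact h (hy ▸ hF.mate_mem)
  · exact h ((hF.step_mem_iff hstep hx hy).1 h')

include hF hstep hμ in
-- The walk enters `F` at its first step and, being periodic, leaves it again; the only exit is from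
-- `μ x`.
theorem IsFarSide.exists_time [Finite P] : ∃ T, 0 < T ∧ step^[T] x = μ x ∧
    ∀ i, 0 < i → i ≤ T → step^[i] x ∈ F := by
  classical
  have hx1 : step x ∈ F := by
    rw [hstep, hF.move_mem]
    exact hF.mate_mem
  have hex : ∃ n, 0 < n ∧ step^[n] x ∉ F := by
    obtain ⟨n, hn, h⟩ := Function.mem_periodicPts.1
      ((step_injective hstep hμ).mem_periodicPts x)
    exact ⟨n, hn, by rw [h]; exact hF.notMem⟩
  obtain ⟨h0, h1⟩ := Nat.find_spec hex
  have hmin : ∀ i, 0 < i → i < Nat.find hex → step^[i] x ∈ F := fun i hi h => by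
    have := Nat.find_min hex h
    simpa [hi] using this
  obtain ⟨T, hT⟩ : ∃ T, Nat.find hex = T + 1 := ⟨Nat.find hex - 1, by omega⟩
  rw [hT] at h1 hmin
  have hT0 : 0 < T := by
    rcases Nat.eq_zero_or_pos T with rfl | h
    · exact (h1 hx1).elim
    · exact h
  have hTF := hmin T hT0 (by omega)
  refine ⟨T, hT0, ?_, fun i hi h => hmin i hi (by omega)⟩
  by_contra hc
  rw [Function.iterate_succ_apply'] at h1
  refine h1 ((hF.step_mem_iff hstep ?_ hc).2 hTF)
  intro h
  exact hF.notMem (h ▸ hTF)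

include hstep hμ in
/-- If all connections are bridges then the walk visits everything. -/
theorem exists_iterate_eq [Finite P] (hbr : ∀ z, μ z ≠ z → ∃ F, IsFarSide s μ z F)
    (hconn : ∀ S : Set P, S.Nonempty → (∀ z ∈ S, s z ∈ S) → (∀ z ∈ S, μ z ∈ S) → S = Set.univ)
    (z w : P) : ∃ n, step^[n] z = w := by
  have hO : ∀ u, (∃ n, step^[n] z = u) → ∃ n, step^[n] z = μ u := by
    rintro u ⟨n, rfl⟩
    by_cases h : μ (step^[n] z) = step^[n] z
    · exact ⟨n, h.symm⟩
    · obtain ⟨F, hF⟩ := hbr _ h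
      obtain ⟨T, -, hT, -⟩ := hF.exists_time hstep hμ
      exact ⟨T + n, by rw [Function.iterate_add_apply, hT]⟩
  have := hconn {u | ∃ n, step^[n] z = u} ⟨z, 0, rfl⟩ (fun u hu => ?_) hO
  · exact this.symm.subset (Set.mem_univ w)
  · obtain ⟨n, hn⟩ := hO u hu
    exact ⟨n + 1, by rw [Function.iterate_succ_apply', hn, hstep, hμ]⟩

include hF hstep hμ in
-- After time `T` the walk is outside `F` and can come back only through `x`; the first visit to `w`
-- would then have occurred one loop earlier.
theorem IsFarSide.exists_time_of_mem (htr : ∀ z w, ∃ n, step^[n] z = w) {T : ℕ} (hT0 : 0 < T)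
    (hT : step^[T] x = μ x) {w : P} (hw : w ∈ F) : ∃ i, 0 < i ∧ i ≤ T ∧ step^[i] x = w := by
  classical
  have hmin := fun i (h : i < Nat.find (htr x w)) => Nat.find_min (htr x w) h
  have hn := Nat.find_spec (htr x w)
  set n := Nat.find (htr x w)
  refine ⟨n, ?_, ?_, hn⟩
  · rcases Nat.eq_zero_or_pos n with h | h
    · rw [h] at hn
      exact (hF.notMem (by rw [show x = w from hn]; exact hw)).elim
    · exact h
  · by_contra hc
    have key : ∀ k, T + 1 + k ≤ n → step^[T + 1 + k] x ∉ F := by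
      intro k
      induction k with
      | zero =>
        intro _
        rw [add_zero, Function.iterate_succ_apply', hT, hstep, hμ, hF.move_mem]
        exact hF.notMem
      | succ k ih =>
        intro hk h
        rw [← add_assoc, Function.iterate_succ_apply'] at h
        have h1 := hF.eq_of_step_mem hstep (ih (by omega)) h
        apply hmin (n - (T + 1 + k)) (by omega)
        conv_lhs => rw [← h1]
        rw [← Function.iterate_add_apply, ← hn]
        congr 2
        omega
    obtain ⟨k, hk⟩ := Nat.exists_eq_add_of_le (show T + 1 ≤ n by omega)
    have := key k hk.ge
    rw [← hk, hn] at this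
    exact this hw

include hF hstep hμ in
theorem IsFarSide.iterate_inj {T : ℕ} (hTF : ∀ i, 0 < i → i ≤ T → step^[i] x ∈ F) {i j : ℕ}
    (hi : i ≤ T) (hj : j ≤ T) (h : step^[i] x = step^[j] x) : i = j := by
  have key : ∀ i j, i < j → j ≤ T → step^[i] x ≠ step^[j] x := by
    intro i j hij hj h
    obtain ⟨k, rfl⟩ := Nat.exists_eq_add_of_lt hij
    rw [add_assoc, Function.iterate_add_apply] at h
    have h' := (step_injective hstep hμ).iterate i h
    have := hTF (k + 1) (by omega) (by omega)
    rw [← h'] at this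
    exact hF.notMem this
  rcases lt_trichotomy i j with h' | h' | h'
  · exact (key i j h' hj h).elim
  · exact h'
  · exact (key j i h' hi h.symm).elim

include hF hstep hμ in
open Classical in
-- From time `1` to time `T` the walk visits each element of `F` exactly once, so sums along the
-- tour are counts in `F`.
theorem IsFarSide.walkSum_eq [Fintype P] (htr : ∀ z w, ∃ n, step^[n] z = w) {T : ℕ} (hT0 : 0 < T)
    (hT : step^[T] x = μ x) (hTF : ∀ i, 0 < i → i ≤ T → step^[i] x ∈ F) (wt : P → ℤ) :
    walkSum step wt x (T + 1) = wt x + ∑ w with w ∈ F, wt w := by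
  rw [walkSum, Finset.sum_range_succ', add_comm]
  congr 1
  refine Finset.sum_bij (fun i _ => step^[i + 1] x) ?_ ?_ ?_ ?_
  · intro i hi
    rw [Finset.mem_range] at hi
    simpa using hTF (i + 1) (by omega) (by omega)
  · intro i hi j hj h
    rw [Finset.mem_range] at hi hj
    have := hF.iterate_inj hstep hμ hTF (i := i + 1) (j := j + 1) (by omega) (by omega) h
    omega
  · intro w hw
    obtain ⟨i, h0, h1, h2⟩ := hF.exists_time_of_mem hstep hμ htr hT0 hT (by simpa using hw)
    refine ⟨i - 1, by rw [Finset.mem_range]; omega, ?_⟩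
    rw [Nat.sub_add_cancel h0]
    exact h2
  · intro i _
    rfl

end FarSide

/-- On a closed walk of total weight zero, the weights are the increments of a height. -/
theorem exists_height {P : Type*} [Fintype P] {step : P → P} (hs : Function.Injective step)
    (htr : ∀ z w, ∃ n, step^[n] z = w) (wt : P → ℤ) (h0 : ∑ w, wt w = 0) (r : P) :
    ∃ e : P → ℤ, ∀ w, e (step w) = e w + wt w := by
  classical
  let pos : P → ℕ := fun w => Nat.find (htr r w)
  have hpos : ∀ w, step^[pos w] r = w := fun w => Nat.find_spec (htr r w)
  have hle : ∀ n, pos (step^[n] r) ≤ n := fun n => Nat.find_min' _ rfl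
  refine ⟨fun w => walkSum step wt r (pos w), fun w => ?_⟩
  have h1 : step^[pos w + 1] r = step w := by rw [Function.iterate_succ_apply', hpos]
  have hws : walkSum step wt r (pos w + 1) = walkSum step wt r (pos w) + wt w := by
    rw [walkSum_succ, hpos]
  have hle' := hle (pos w + 1)
  rw [h1] at hle'
  dsimp only
  rw [← hws]
  rcases hle'.lt_or_eq with h | h
  -- The walk has closed up: an earlier position other than `0` would have a predecessor reaching
  -- `w` before its first visit. The total weight zero then makes the height consistent.
  · have h2 : pos (step w) = 0 := by
      by_contra hc
      obtain ⟨k, hk⟩ := Nat.exists_eq_succ_of_ne_zero hc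
      have h3 := hpos (step w)
      rw [hk, Function.iterate_succ_apply'] at h3
      have h4 := hs h3
      have h5 : pos w ≤ k := by rw [← h4]; exact hle k
      omega
    rw [h2, walkSum_zero, ← h0, walkSum, eq_comm]
    have hr : step^[pos w + 1] r = r := by
      rw [h1]
      conv_lhs => rw [← hpos (step w), h2]
      rfl
    refine Finset.sum_bij (fun i _ => step^[i] r) (by simp) ?_ ?_ (fun _ _ => rfl)
    · have key : ∀ i j, i < j → j < pos w + 1 → step^[i] r ≠ step^[j] r := by
        intro i j hij hj h
        have h6 : step^[pos w - j + i] r = w := by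
          rw [Function.iterate_add_apply, h, ← Function.iterate_add_apply,
            Nat.sub_add_cancel (by omega), hpos]
        have := hle (pos w - j + i)
        rw [h6] at this
        omega
      intro i hi j hj h
      rw [Finset.mem_range] at hi hj
      rcases lt_trichotomy i j with h' | h' | h'
      · exact (key i j h' hj h).elim
      · exact h'
      · exact (key j i h' hi h.symm).elim
    · intro u _
      have : ∀ n, ∃ i < pos w + 1, step^[i] r = step^[n] r := by
        intro n
        induction n with
        | zero => exact ⟨0, by omega, rfl⟩
        | succ n ih =>
          obtain ⟨i, hi, hi'⟩ := ih
          rcases Nat.lt_or_ge (i + 1) (pos w + 1) with h | h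
          · exact ⟨i + 1, h, by rw [Function.iterate_succ_apply', hi', Function.iterate_succ_apply']⟩
          · refine ⟨0, by omega, ?_⟩
            rw [show i = pos w by omega] at hi'
            rw [Function.iterate_succ_apply', ← hi', ← Function.iterate_succ_apply' step]
            exact hr.symm
      obtain ⟨i, hi, h⟩ := this (pos u)
      exact ⟨i, Finset.mem_range.2 hi, by rw [h, hpos]⟩
  · rw [h]

end Rewiring

namespace Rewiring

/-! ### Moving around necklaces -/

section Pearls

variable {V : Type*} {word : V → List Letter}

/-- The clockwise rotation of all necklaces. -/
def succPerm (word : V → List Letter) : Equiv.Perm (Pearl word) where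
  toFun := Pearl.succ
  invFun := Pearl.pred
  left_inv x := by rw [Pearl.succ, Pearl.pred, add_sub_cancel_right]
  right_inv x := by rw [Pearl.succ, Pearl.pred, sub_add_cancel]

/-- A rotation moves around each necklace and visits all its pearls. -/
structure IsRotation (s : Equiv.Perm (Pearl word)) : Prop where
  fst_eq : ∀ z, (s z).1 = z.1
  mem_of_mem : ∀ S : Set (Pearl word), (∀ z ∈ S, s z ∈ S) → ∀ z ∈ S, ∀ w, w.1 = z.1 → w ∈ S

open Fin.NatCast Fin.CommRing in
theorem isRotation_succPerm : IsRotation (succPerm word) where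
  fst_eq _ := rfl
  mem_of_mem S hS := by
    rintro ⟨v, i⟩ hz ⟨v', j⟩ h
    obtain rfl : v' = v := h
    have key : ∀ k : ℕ, (⟨v', i + (k : Fin ((word v').length + 1))⟩ : Pearl word) ∈ S := by
      intro k
      induction k with
      | zero => simpa using hz
      | succ k ih =>
        have := hS _ ih
        simpa [succPerm, Pearl.succ, add_assoc] using this
    simpa using key (j - i).val

open Fin.NatCast Fin.CommRing in
theorem isRotation_succPerm_symm : IsRotation (succPerm word).symm where
  fst_eq _ := rfl
  mem_of_mem S hS := by
    rintro ⟨v, i⟩ hz ⟨v', j⟩ h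
    obtain rfl : v' = v := h
    have key : ∀ k : ℕ, (⟨v', i - (k : Fin ((word v').length + 1))⟩ : Pearl word) ∈ S := by
      intro k
      induction k with
      | zero => simpa using hz
      | succ k ih =>
        have := hS _ ih
        simpa [succPerm, Pearl.pred, sub_sub] using this
    simpa using key (i - j).val

/-- Bullets and diamonds own the edge to which they are incident. -/
def Pearl.IsOwner (x : Pearl word) : Prop := x.kind = .bullet ∨ x.kind = .diamond

theorem Letter.kind_ne_square (l : Letter) : l.kind ≠ .square := by cases l <;> simp [Letter.kind]

theorem Pearl.kind_eq_square_iff {x : Pearl word} : x.kind = .square ↔ x.2 = 0 := by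
  obtain ⟨v, i⟩ := x
  refine Fin.cases ?_ (fun i => ?_) i
  · simp [Pearl.kind]
  · simp [Pearl.kind, Letter.kind_ne_square, Fin.succ_ne_zero]

theorem ncard_square [Finite V] : {x : Pearl word | x.kind = .square}.ncard = Nat.card V := by
  rw [← Set.ncard_univ, eq_comm]
  refine Set.ncard_congr (fun v _ => ⟨v, 0⟩) (fun v _ => Pearl.kind_eq_square_iff.2 rfl) ?_ ?_
  · intro v w _ _ h
    exact congrArg Sigma.fst h
  · rintro ⟨v, i⟩ h
    obtain rfl : i = 0 := Pearl.kind_eq_square_iff.1 h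
    exact ⟨v, trivial, rfl⟩

theorem ncard_squares_over (S : Set V) :
    {x : Pearl word | x.1 ∈ S ∧ x.kind = .square}.ncard = S.ncard := by
  refine (Set.ncard_congr (fun v _ => ⟨v, 0⟩) ?_ ?_ ?_).symm
  · intro v hv
    exact ⟨hv, Pearl.kind_eq_square_iff.2 rfl⟩
  · intro v w _ _ h
    exact congrArg Sigma.fst h
  · rintro ⟨v, i⟩ ⟨h', h⟩
    obtain rfl : i = 0 := Pearl.kind_eq_square_iff.1 h
    exact ⟨v, h', rfl⟩

end Pearls

namespace PearlGraph

variable {V : Type*} {m m' : PearlGraph V}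

/-- Each bullet or diamond is joined by an edge to exactly one square or triangle, and each square
or triangle is incident to at most one edge. -/
structure IsMatching (m : PearlGraph V) : Prop where
  owner : ∀ {x y}, m.edge x y → x.IsOwner
  not_owner : ∀ {x y}, m.edge x y → ¬ y.IsOwner
  exists_edge : ∀ {x : Pearl m.word}, x.IsOwner → ∃ y, m.edge x y
  right_unique : ∀ {x y y'}, m.edge x y → m.edge x y' → y = y'
  left_unique : ∀ {x x' y}, m.edge x y → m.edge x' y → x = x'

namespace IsMatching

variable (hm : m.IsMatching)
include hm

theorem joined_unique {x y y' : Pearl m.word} (h : m.Joined x y) (h' : m.Joined x y') :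
    y = y' := by
  rcases h with h | h <;> rcases h' with h' | h'
  · exact hm.right_unique h h'
  · exact (hm.not_owner h' (hm.owner h)).elim
  · exact (hm.not_owner h (hm.owner h')).elim
  · exact hm.left_unique h h'

theorem ne_of_joined {x y : Pearl m.word} (h : m.Joined x y) : x ≠ y := by
  rintro rfl
  rcases h with h | h <;> exact hm.not_owner h (hm.owner h)

theorem mate_eq {x y : Pearl m.word} (h : m.Joined x y) : m.mate x = y := by
  have hex : ∃ y, m.Joined x y := ⟨y, h⟩
  rw [mate, dif_pos hex]
  exact hm.joined_unique hex.choose_spec h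

omit hm in
theorem _root_.Rewiring.PearlGraph.mate_of_isFree {x : Pearl m.word} (h : m.IsFree x) :
    m.mate x = x := dif_neg fun ⟨y, hy⟩ => h y hy

omit hm in
theorem _root_.Rewiring.PearlGraph.joined_symm {x y : Pearl m.word} (h : m.Joined x y) :
    m.Joined y x := h.symm

theorem mate_mate (x : Pearl m.word) : m.mate (m.mate x) = x := by
  by_cases h : m.IsFree x
  · rw [mate_of_isFree h, mate_of_isFree h]
  · obtain ⟨y, hy⟩ := not_forall_not.1 h
    rw [hm.mate_eq hy, hm.mate_eq (joined_symm hy)]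

theorem joined_mate {x : Pearl m.word} (h : m.mate x ≠ x) : m.Joined x (m.mate x) := by
  by_cases h' : m.IsFree x
  · exact (h (mate_of_isFree h')).elim
  · obtain ⟨y, hy⟩ := not_forall_not.1 h'
    rwa [hm.mate_eq hy]

theorem edge_mate {x : Pearl m.word} (h : x.IsOwner) : m.edge x (m.mate x) := by
  obtain ⟨y, hy⟩ := hm.exists_edge h
  rwa [hm.mate_eq (.inl hy)]

theorem mate_ne {x : Pearl m.word} (h : x.IsOwner) : m.mate x ≠ x :=
  (hm.ne_of_joined (.inl (hm.edge_mate h))).symm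

omit hm in
theorem _root_.Rewiring.PearlGraph.skeleton_adj_inl {v : V} {x : Pearl m.word} :
    m.skeleton.Adj (.inl v) (.inr x) ↔ x.1 = v := by
  simp [skeleton, skeletonRel]

omit hm in
theorem _root_.Rewiring.PearlGraph.not_skeleton_adj_inl {v w : V} :
    ¬ m.skeleton.Adj (.inl v) (.inl w) := by
  simp [skeleton, skeletonRel]

theorem skeleton_adj_inr {x y : Pearl m.word} :
    m.skeleton.Adj (.inr x) (.inr y) ↔ m.Joined x y := by
  refine ⟨fun h => h.2, fun h => ⟨fun h' => hm.ne_of_joined h (Sum.inr_injective h'), h⟩⟩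

end IsMatching

/-! ### Counting edges -/

section Count

/-- The edges of the skeleton: the attachments of the pearls to their vertices, and the edges
between pearls, each indexed by the pearl that owns it. -/
noncomputable def skeletonEdge (m : PearlGraph V) :
    Pearl m.word ⊕ Pearl m.word → Sym2 (V ⊕ Pearl m.word)
  | .inl z => s(.inl z.1, .inr z)
  | .inr x => s(.inr x, .inr (m.mate x))

variable (hm : m.IsMatching)
include hm

theorem IsMatching.edgeSet_eq : m.skeleton.edgeSet =
    m.skeletonEdge '' (Set.range Sum.inl ∪ Sum.inr '' {x | x.IsOwner}) := by
  ext e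
  induction e with
  | _ a b =>
  rw [SimpleGraph.mem_edgeSet]
  constructor
  · intro h
    rcases a with v | x <;> rcases b with w | y
    · exact (not_skeleton_adj_inl h).elim
    · obtain rfl := skeleton_adj_inl.1 h
      exact ⟨.inl y, .inl ⟨y, rfl⟩, rfl⟩
    · obtain rfl := skeleton_adj_inl.1 h.symm
      exact ⟨.inl x, .inl ⟨x, rfl⟩, Sym2.eq_swap⟩
    · rcases hm.skeleton_adj_inr.1 h with h | h
      · refine ⟨.inr x, .inr ⟨x, hm.owner h, rfl⟩, ?_⟩
        change s(_, _) = _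
        rw [hm.mate_eq (.inl h)]
      · refine ⟨.inr y, .inr ⟨y, hm.owner h, rfl⟩, ?_⟩
        change s(_, _) = _
        rw [hm.mate_eq (.inl h)]
        exact Sym2.eq_swap
  · rintro ⟨_, ⟨z, rfl⟩ | ⟨x, hx, rfl⟩, h⟩
    · rw [← SimpleGraph.mem_edgeSet, ← h]
      exact skeleton_adj_inl.2 rfl
    · rw [← SimpleGraph.mem_edgeSet, ← h]
      exact hm.skeleton_adj_inr.2 (.inl (hm.edge_mate hx))

theorem IsMatching.skeletonEdge_injOn :
    Set.InjOn m.skeletonEdge (Set.range Sum.inl ∪ Sum.inr '' {x | x.IsOwner}) := by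
  rintro _ (⟨z, rfl⟩ | ⟨x, hx, rfl⟩) _ (⟨w, rfl⟩ | ⟨y, hy, rfl⟩) h
  · have h' : s((Sum.inl z.1 : V ⊕ Pearl m.word), Sum.inr z) = s(Sum.inl w.1, Sum.inr w) := h
    simp only [Sym2.eq_iff, Sum.inl.injEq, Sum.inr.injEq, reduceCtorEq, false_and, or_false] at h'
    rw [h'.2]
  · have h' : s((Sum.inl z.1 : V ⊕ Pearl m.word), Sum.inr z) = s(Sum.inr y, Sum.inr _) := h
    simp at h'
  · have h' : s((Sum.inl w.1 : V ⊕ Pearl m.word), Sum.inr w) = s(Sum.inr x, Sum.inr _) := h.symm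
    simp at h'
  · have h' : s((Sum.inr x : V ⊕ Pearl m.word), Sum.inr (m.mate x)) =
      s(Sum.inr y, Sum.inr (m.mate y)) := h
    simp only [Sym2.eq_iff, Sum.inr.injEq] at h'
    rcases h' with h' | h'
    · rw [h'.1]
    · exact (hm.not_owner (hm.edge_mate hy) (h'.1 ▸ hx)).elim

/-- In the count of vertices and edges of the skeleton, the pearls cancel against their attachments,
leaving one edge per owner. -/
theorem IsMatching.isTree_iff [Finite V] :
    m.IsTree ↔ m.skeleton.Connected ∧ {x : Pearl m.word | x.IsOwner}.ncard + 1 = Nat.card V := by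
  rw [IsTree, SimpleGraph.isTree_iff_connected_and_card]
  have : Nat.card m.skeleton.edgeSet =
      Nat.card (Pearl m.word) + {x : Pearl m.word | x.IsOwner}.ncard := by
    rw [Nat.card_coe_set_eq, hm.edgeSet_eq, hm.skeletonEdge_injOn.ncard_image,
      Set.ncard_union_eq, ← Set.image_univ, Set.ncard_image_of_injective _ Sum.inl_injective,
      Set.ncard_image_of_injective _ Sum.inr_injective, Set.ncard_univ]
    rw [Set.disjoint_left]
    rintro _ ⟨z, rfl⟩ ⟨x, _, h⟩
    cases h
  rw [this, Nat.card_sum]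
  refine and_congr_right fun _ => ?_
  omega

/-- A connected graph has at most one vertex more than it has edges. By `hKv` necklaces stay whole,
so pearls cancel against their attachments and squares stand for vertices. -/
theorem IsMatching.ncard_component_le [Finite V] {K : SimpleGraph (V ⊕ Pearl m.word)}
    (hK : K ≤ m.skeleton) (hKv : ∀ x : Pearl m.word, K.Adj (.inl x.1) (.inr x))
    (C : K.ConnectedComponent) :
    {x | Sum.inr x ∈ C.supp ∧ x.kind = .square}.ncard ≤
      {x | Sum.inr x ∈ C.supp ∧ x.IsOwner ∧ K.Adj (.inr x) (.inr (m.mate x))}.ncard + 1 := by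
  have h1 := C.connected_toSimpleGraph.card_vert_le_card_edgeSet_add_one
  have hv : ∀ x : Pearl m.word, Sum.inl x.1 ∈ C.supp ↔ Sum.inr x ∈ C.supp := fun x =>
    C.mem_supp_congr_adj (hKv x)
  have h2 : Nat.card C = {x | Sum.inr x ∈ C.supp ∧ x.kind = .square}.ncard +
      {x : Pearl m.word | Sum.inr x ∈ C.supp}.ncard := by
    rw [show Nat.card C = C.supp.ncard from Nat.card_coe_set_eq _]
    conv_lhs => rw [← Set.image_preimage_inl_union_image_preimage_inr C.supp]
    rw [Set.ncard_union_eq, Set.ncard_image_of_injective _ Sum.inl_injective,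
      Set.ncard_image_of_injective _ Sum.inr_injective]
    · congr 1
      rw [← ncard_squares_over (word := m.word)]
      congr 1
      ext x
      exact and_congr_left fun _ => hv x
    · rw [Set.disjoint_left]
      rintro _ ⟨z, _, rfl⟩ ⟨x, _, h⟩
      cases h
  have h3 : Nat.card C.toSimpleGraph.edgeSet ≤ {x : Pearl m.word | Sum.inr x ∈ C.supp}.ncard +
      {x | Sum.inr x ∈ C.supp ∧ x.IsOwner ∧ K.Adj (.inr x) (.inr (m.mate x))}.ncard := by
    rw [Nat.card_coe_set_eq, ← Set.ncard_image_of_injective _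
      (Sym2.map.injective Subtype.val_injective),
      ← Set.ncard_image_of_injective {x | Sum.inr x ∈ C.supp} (f := Sum.inl (β := Pearl m.word))
        Sum.inl_injective,
      ← Set.ncard_image_of_injective {x | Sum.inr x ∈ C.supp ∧ x.IsOwner ∧
        K.Adj (.inr x) (.inr (m.mate x))} (f := Sum.inr (α := Pearl m.word)) Sum.inr_injective]
    refine le_trans ?_ (Set.ncard_union_le _ _)
    refine le_trans (Set.ncard_le_ncard ?_) (Set.ncard_image_le (f := m.skeletonEdge))
    rintro _ ⟨e, he, rfl⟩
    induction e with
    | _ a b =>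
    obtain ⟨a, ha⟩ := a
    obtain ⟨b, hb⟩ := b
    rw [SimpleGraph.mem_edgeSet, SimpleGraph.ConnectedComponent.toSimpleGraph_adj] at he
    have he' := hK he
    rw [Sym2.map_mk]
    rcases a with v | x <;> rcases b with w | y
    · exact (not_skeleton_adj_inl he').elim
    · obtain rfl := skeleton_adj_inl.1 he'
      exact ⟨.inl y, .inl ⟨y, hb, rfl⟩, rfl⟩
    · obtain rfl := skeleton_adj_inl.1 he'.symm
      exact ⟨.inl x, .inl ⟨x, ha, rfl⟩, Sym2.eq_swap⟩
    · rcases hm.skeleton_adj_inr.1 he' with h | h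
      · have h4 := hm.mate_eq (.inl h)
        refine ⟨.inr x, .inr ⟨x, ⟨ha, hm.owner h, h4 ▸ he⟩, rfl⟩, ?_⟩
        change s(_, _) = _
        rw [h4]
      · have h4 := hm.mate_eq (.inl h)
        refine ⟨.inr y, .inr ⟨y, ⟨hb, hm.owner h, h4 ▸ he.symm⟩, rfl⟩, ?_⟩
        change s(_, _) = _
        rw [h4]
        exact Sym2.eq_swap
  omega

end Count

end PearlGraph

end Rewiring

namespace Rewiring
namespace PearlGraph

variable {V : Type*} {m : PearlGraph V}

/-! ### The two sides of an edge of a tree -/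

/-- The pearls that remain connected to `y` when the edge between `x` and `y` is deleted. -/
def farSide (m : PearlGraph V) (x y : Pearl m.word) : Set (Pearl m.word) :=
  {z | (m.skeleton.deleteEdges {s(.inr x, .inr y)}).Reachable (.inr y) (.inr z)}

theorem deleteEdges_adj_inl (x y z : Pearl m.word) :
    (m.skeleton.deleteEdges {s(.inr x, .inr y)}).Adj (.inl z.1) (.inr z) := by
  rw [SimpleGraph.deleteEdges_adj]
  exact ⟨skeleton_adj_inl.2 rfl, by simp⟩

theorem reachable_deleteEdges_or (hc : m.skeleton.Connected) (x y : Pearl m.word)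
    (a : V ⊕ Pearl m.word) :
    (m.skeleton.deleteEdges {s(.inr x, .inr y)}).Reachable (.inr x) a ∨
      (m.skeleton.deleteEdges {s(.inr x, .inr y)}).Reachable (.inr y) a := by
  set K := m.skeleton.deleteEdges {s(.inr x, .inr y)} with hK
  have key : ∀ a b, m.skeleton.Walk a b → (K.Reachable (.inr x) a ∨ K.Reachable (.inr y) a) →
      (K.Reachable (.inr x) b ∨ K.Reachable (.inr y) b) := by
    intro a b p
    induction p with
    | nil => exact id
    | @cons a b _ h _ ih =>
      intro hab
      apply ih
      by_cases he : s(a, b) = s(.inr x, .inr y)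
      · rw [Sym2.eq_iff] at he
        rcases he with ⟨-, rfl⟩ | ⟨-, rfl⟩
        exacts [.inr (.refl _), .inl (.refl _)]
      · have hK' : K.Adj a b := by
          rw [hK, SimpleGraph.deleteEdges_adj, Set.mem_singleton_iff]
          exact ⟨h, he⟩
        exact hab.imp (·.trans hK'.reachable) (·.trans hK'.reachable)
  obtain ⟨p⟩ := hc.preconnected (.inr x) a
  exact key _ _ p (.inl (.refl _))

theorem mem_farSide_of_fst_eq {x y z w : Pearl m.word} (h : z.1 = w.1)
    (hz : z ∈ m.farSide x y) : w ∈ m.farSide x y := by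
  refine SimpleGraph.Reachable.trans hz ?_
  refine (deleteEdges_adj_inl x y z).symm.reachable.trans ?_
  rw [h]
  exact (deleteEdges_adj_inl x y w).reachable

section

variable (hm : m.IsMatching)
include hm

/-- Acyclicity makes the edge at `x` a bridge, and its deletion leaves the necklaces whole. -/
theorem IsMatching.isFarSide (ht : m.IsTree) {s : Equiv.Perm (Pearl m.word)} (hs : IsRotation s)
    {x : Pearl m.word} (hx : m.mate x ≠ x) :
    IsFarSide s m.mate x (m.farSide x (m.mate x)) where
  notMem h := by
    have hadj := hm.skeleton_adj_inr.2 (hm.joined_mate hx)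
    have := SimpleGraph.isAcyclic_iff_forall_adj_isBridge.1 ht.isAcyclic hadj
    exact (SimpleGraph.isBridge_iff.1 this) (SimpleGraph.Reachable.symm h)
  mate_mem := SimpleGraph.Reachable.refl _
  move_mem z := ⟨mem_farSide_of_fst_eq (hs.fst_eq z), mem_farSide_of_fst_eq (hs.fst_eq z).symm⟩
  mate_mem_iff z h h' := by
    by_cases hz : m.mate z = z
    · rw [hz]
    have hadj : (m.skeleton.deleteEdges {s(.inr x, .inr (m.mate x))}).Adj (.inr z)
        (.inr (m.mate z)) := by
      rw [SimpleGraph.deleteEdges_adj]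
      refine ⟨hm.skeleton_adj_inr.2 (hm.joined_mate hz), ?_⟩
      simp [h, h']
    exact ⟨fun h => SimpleGraph.Reachable.trans h hadj.symm.reachable,
      fun h => SimpleGraph.Reachable.trans h hadj.reachable⟩

theorem IsMatching.eq_univ_of_closed (hc : m.skeleton.Connected) {s : Equiv.Perm (Pearl m.word)}
    (hs : IsRotation s) (S : Set (Pearl m.word)) (hS : S.Nonempty) (h1 : ∀ z ∈ S, s z ∈ S)
    (h2 : ∀ z ∈ S, m.mate z ∈ S) : S = Set.univ := by
  obtain ⟨z, hz⟩ := hS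
  let T : V ⊕ Pearl m.word → Prop := Sum.elim (fun v => ∀ w : Pearl m.word, w.1 = v → w ∈ S) (· ∈ S)
  have key : ∀ a b, m.skeleton.Adj a b → T a → T b := by
    rintro (v | x) (w | y) hab ha
    · exact (not_skeleton_adj_inl hab).elim
    · exact ha y (skeleton_adj_inl.1 hab)
    · intro u hu
      exact hs.mem_of_mem S h1 x ha u (hu.trans (skeleton_adj_inl.1 hab.symm).symm)
    · have := h2 x ha
      rwa [hm.mate_eq (hm.skeleton_adj_inr.1 hab)] at this
  have key' : ∀ a b, m.skeleton.Walk a b → T a → T b := by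
    intro a b p
    induction p with
    | nil => exact id
    | cons h _ ih => exact fun ha => ih (key _ _ h ha)
  ext w
  obtain ⟨p⟩ := hc.preconnected (.inr z) (.inr w)
  exact ⟨fun _ => trivial, fun _ => key' _ _ p hz⟩

theorem IsMatching.exists_iterate_eq [Finite V] (ht : m.IsTree) {s : Equiv.Perm (Pearl m.word)}
    (hs : IsRotation s) {step : Pearl m.word → Pearl m.word} (hstep : ∀ z, step z = s (m.mate z))
    (z w : Pearl m.word) : ∃ n, step^[n] z = w :=
  Rewiring.exists_iterate_eq hstep hm.mate_mate (fun _ hz => ⟨_, hm.isFarSide ht hs hz⟩)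
    (hm.eq_univ_of_closed ht.connected hs) z w

/-- This does not presuppose a tree: it serves to prove that the graph obtained by exchange is
connected. -/
theorem IsMatching.reachable_iterate {s : Equiv.Perm (Pearl m.word)}
    (hs : IsRotation s) {step : Pearl m.word → Pearl m.word} (hstep : ∀ z, step z = s (m.mate z))
    (z : Pearl m.word) (n : ℕ) : m.skeleton.Reachable (.inr z) (.inr (step^[n] z)) := by
  induction n with
  | zero => exact .refl _
  | succ n ih =>
    refine ih.trans ?_
    rw [Function.iterate_succ_apply', hstep]
    generalize step^[n] z = u
    have h1 : m.skeleton.Reachable (.inr u) (.inr (m.mate u)) := by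
      by_cases h : m.mate u = u
      · rw [h]
      · exact (hm.skeleton_adj_inr.2 (hm.joined_mate h)).reachable
    refine h1.trans ((skeleton_adj_inl.2 rfl).symm.reachable.trans
      (skeleton_adj_inl.2 (hs.fst_eq _)).reachable)

/-- Both components left by the deleted edge obey `ncard_component_le`, and the total count in the
tree forces equality in both bounds. -/
theorem IsMatching.ncard_farSide [Finite V] (ht : m.IsTree) {x : Pearl m.word} (hx : x.IsOwner) :
    {z ∈ m.farSide x (m.mate x) | z.kind = .square}.ncard =
      {z ∈ m.farSide x (m.mate x) | z.IsOwner}.ncard + 1 := by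
  set y := m.mate x with hy
  set K := m.skeleton.deleteEdges {s(.inr x, .inr y)} with hK
  have hKle : K ≤ m.skeleton := SimpleGraph.deleteEdges_le _
  have hKadj : ∀ {a b}, K.Adj a b ↔ m.skeleton.Adj a b ∧ s(a, b) ≠ s(.inr x, .inr y) := by
    intro a b
    rw [hK, SimpleGraph.deleteEdges_adj, Set.mem_singleton_iff]
  have hedge := hm.edge_mate hx
  have hyo := hm.not_owner hedge
  have h1 := hm.ncard_component_le hKle (deleteEdges_adj_inl x y) (K.connectedComponentMk (.inr x))
  have h2 := hm.ncard_component_le hKle (deleteEdges_adj_inl x y) (K.connectedComponentMk (.inr y))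
  have hno : ¬ K.Reachable (.inr x) (.inr y) :=
    SimpleGraph.isBridge_iff.1 (SimpleGraph.isAcyclic_iff_forall_adj_isBridge.1 ht.isAcyclic
      (hm.skeleton_adj_inr.2 (.inl hedge)))
  have hcov : ∀ a, K.Reachable (.inr x) a ∨ K.Reachable (.inr y) a :=
    reachable_deleteEdges_or ht.connected x y
  have hmem : ∀ z a, a ∈ (K.connectedComponentMk (.inr z)).supp ↔ K.Reachable (.inr z) a := by
    intro z a
    rw [SimpleGraph.ConnectedComponent.mem_supp_iff, SimpleGraph.ConnectedComponent.eq]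
    exact SimpleGraph.reachable_comm
  have hdis : ∀ a, K.Reachable (.inr x) a → ¬ K.Reachable (.inr y) a :=
    fun a h h' => hno (h.trans h'.symm)
  have hsq : {z | Sum.inr z ∈ (K.connectedComponentMk (.inr x)).supp ∧ z.kind = .square}.ncard +
      {z ∈ m.farSide x y | z.kind = .square}.ncard = Nat.card V := by
    rw [← ncard_square (word := m.word), ← Set.ncard_union_eq]
    · congr 1
      ext z
      simp only [Set.mem_union, Set.mem_ofPred_eq, hmem, ← or_and_right]
      exact and_iff_right (hcov (.inr z))
    · rw [Set.disjoint_left]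
      rintro z ⟨h, _⟩ ⟨h', _⟩
      exact hdis _ ((hmem _ _).1 h) h'
  have how : {z | Sum.inr z ∈ (K.connectedComponentMk (.inr x)).supp ∧ z.IsOwner ∧
      K.Adj (.inr z) (.inr (m.mate z))}.ncard + {z ∈ m.farSide x y | z.IsOwner}.ncard + 1 =
      {z : Pearl m.word | z.IsOwner}.ncard := by
    rw [← Set.ncard_sdiff_singleton_add_one (a := x) (s := {z : Pearl m.word | z.IsOwner}) hx,
      ← Set.ncard_union_eq]
    · congr 2
      ext z
      simp only [Set.mem_union, Set.mem_ofPred_eq, hmem, Set.mem_sdiff, Set.mem_singleton_iff]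
      constructor
      · rintro (⟨-, h, h'⟩ | ⟨h, h'⟩)
        · refine ⟨h, ?_⟩
          rintro rfl
          exact (hKadj.1 h').2 rfl
        · refine ⟨h', ?_⟩
          rintro rfl
          exact hno (SimpleGraph.Reachable.symm h)
      · rintro ⟨h, h'⟩
        rcases hcov (.inr z) with h3 | h3
        · refine .inl ⟨h3, h, hKadj.2 ⟨hm.skeleton_adj_inr.2 (.inl (hm.edge_mate h)), ?_⟩⟩
          intro he
          simp only [Sym2.eq_iff, Sum.inr.injEq] at he
          rcases he with he | he
          · exact h' he.1
          · rw [he.1] at h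
            exact hyo h
        · exact .inr ⟨h3, h⟩
    · rw [Set.disjoint_left]
      rintro z ⟨h, _⟩ ⟨h', _⟩
      exact hdis _ ((hmem _ _).1 h) h'
  have htot := (hm.isTree_iff.1 ht).2
  have h2' : {z ∈ m.farSide x y | z.kind = .square}.ncard ≤
      {z ∈ m.farSide x y | z.IsOwner}.ncard + 1 := by
    refine le_trans (le_of_eq ?_) (h2.trans (Nat.add_le_add_right (Set.ncard_le_ncard ?_) 1))
    · congr 1
      ext z
      exact and_congr_left fun _ => (hmem y (.inr z)).symm
    · rintro z ⟨h, h', _⟩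
      exact ⟨(hmem y (.inr z)).1 h, h'⟩
  omega

end

/-- A graph is connected if the ends of all edges of some connected graph on the same necklaces are
connected in it. -/
theorem skeleton_connected_of_reachable {w : V → List Letter} {E E' : Pearl w → Pearl w → Prop}
    {r r' : Pearl w} (h : (mk w E r).skeleton.Connected)
    (hE : ∀ x y, E x y → (mk w E' r').skeleton.Reachable (.inr x) (.inr y)) :
    (mk w E' r').skeleton.Connected := by
  have key : ∀ a b, (mk w E r).skeleton.Adj a b → (mk w E' r').skeleton.Reachable a b := by
    rintro (v | x) (u | y) hab
    · exact (not_skeleton_adj_inl hab).elim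
    · exact ((skeleton_adj_inl (m := mk w E' r')).2 (skeleton_adj_inl.1 hab)).reachable
    · exact ((skeleton_adj_inl (m := mk w E' r')).2 (skeleton_adj_inl.1 hab.symm)).symm.reachable
    · rcases hab.2 with h | h
      exacts [hE _ _ h, (hE _ _ h).symm]
  have := h.nonempty
  refine ⟨fun a b => ?_⟩
  obtain ⟨p⟩ := h.preconnected a b
  induction p with
  | nil => exact .refl _
  | cons h _ ih => exact (key _ _ h).trans ih

end PearlGraph
end Rewiring

namespace Rewiring

/-- The positions of the corners on a closed walk started at `r`. -/
theorem exists_position {P : Type*} {step : P → P} (hs : Function.Injective step)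
    (htr : ∀ z w, ∃ n, step^[n] z = w) (r : P) :
    ∃ pos : P → ℕ, (∀ w, step^[pos w] r = w) ∧ (∀ n, pos (step^[n] r) ≤ n) ∧
      ∀ x n, (∀ i, 0 < i → i ≤ n → step^[i] x ≠ r) → pos (step^[n] x) = pos x + n := by
  classical
  have hpos : ∀ w, step^[Nat.find (htr r w)] r = w := fun w => Nat.find_spec (htr r w)
  have hle : ∀ n, Nat.find (htr r (step^[n] r)) ≤ n := fun n => Nat.find_min' _ rfl
  refine ⟨fun w => Nat.find (htr r w), hpos, hle, fun x n h => ?_⟩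
  have h1 := hle (n + Nat.find (htr r x))
  rw [Function.iterate_add_apply, hpos] at h1
  have h2 := hpos (step^[n] x)
  dsimp only
  set q := Nat.find (htr r (step^[n] x))
  rcases Nat.lt_or_ge q n with h3 | h3
  · refine (h (n - q) (by omega) (by omega) ?_).elim
    apply hs.iterate q
    rw [← Function.iterate_add_apply, show q + (n - q) = n by omega, h2]
  · have h4 : step^[q - n] r = x := by
      apply hs.iterate n
      rw [← Function.iterate_add_apply, show n + (q - n) = q by omega, h2]
    have := hle (q - n)
    rw [h4] at this
    omega

/-- The difference of two indicators. -/
noncomputable def weight {P : Type*} (A B : Set P) : P → ℤ := A.indicator 1 - B.indicator 1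

theorem sum_weight {P : Type*} [Fintype P] (A B S : Set P) [DecidablePred (· ∈ S)] :
    ∑ w with w ∈ S, weight A B w = ((S ∩ A).ncard : ℤ) - ((S ∩ B).ncard : ℤ) := by
  classical
  have h : ∀ A : Set P, ∑ w with w ∈ S, A.indicator (1 : P → ℤ) w = ((S ∩ A).ncard : ℤ) := by
    intro A
    simp only [Set.indicator_apply, Pi.one_apply]
    rw [Finset.sum_boole, Set.ncard_eq_toFinset_card']
    congr 2
    ext w
    simp
  simp only [weight, Pi.sub_apply, Finset.sum_sub_distrib, h]

theorem isWeight_weight {P : Type*} {A B : Set P} (h : Disjoint A B) :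
    IsWeight (weight A B) A B (A ∪ B)ᶜ where
  mem z := by
    by_cases h1 : z ∈ A
    · exact .inl h1
    by_cases h2 : z ∈ B
    · exact .inr (.inl h2)
    · exact .inr (.inr (by simp [h1, h2]))
  out z hz := by
    have := Set.disjoint_left.1 h hz
    simp [weight, hz, this]
  inc z hz := by
    have := Set.disjoint_right.1 h hz
    simp [weight, hz, this]
  neutral z hz := by
    rw [Set.mem_compl_iff, Set.mem_union, not_or] at hz
    simp [weight, hz.1, hz.2]

namespace PearlGraph

variable {V : Type*} {m : PearlGraph V}

/-! ### Subtrees -/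

theorem farSide_subset_subtree {x y : Pearl m.word} (hr : m.root ∉ m.farSide x y) : m.farSide x y ⊆ m.subtree x := by
  intro z hz p
  have key : ∀ a b, ∀ p : m.skeleton.Walk a b,
      ¬ (m.skeleton.deleteEdges {s(.inr x, .inr y)}).Reachable (.inr y) a →
      (m.skeleton.deleteEdges {s(.inr x, .inr y)}).Reachable (.inr y) b →
      .inr x ∈ p.support := by
    intro a b p
    induction p with
    | nil => exact fun h h' => (h h').elim
    | @cons a b _ h p ih =>
      intro ha hc
      rw [SimpleGraph.Walk.support_cons, List.mem_cons]
      by_cases hb : (m.skeleton.deleteEdges {s(.inr x, .inr y)}).Reachable (.inr y) b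
      · left
        by_cases he : s(a, b) = s(.inr x, .inr y)
        · rw [Sym2.eq_iff] at he
          rcases he with ⟨h1, -⟩ | ⟨h1, -⟩
          · exact h1.symm
          · exact (ha (h1 ▸ .refl _)).elim
        · refine (ha (hb.trans (SimpleGraph.Adj.reachable ?_))).elim
          rw [SimpleGraph.deleteEdges_adj, Set.mem_singleton_iff]
          exact ⟨h.symm, by rwa [Sym2.eq_swap]⟩
      · exact .inr (ih hb hc)
  exact key _ _ p hr hz

theorem mem_subtree_self (x : Pearl m.word) : x ∈ m.subtree x :=
  fun p => p.end_mem_support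

theorem subtree_root : m.subtree m.root = Set.univ :=
  Set.eq_univ_of_forall fun _ p => p.start_mem_support

theorem mem_subtree_trans {x y z : Pearl m.word} (hy : y ∈ m.subtree x) (hz : z ∈ m.subtree y) :
    z ∈ m.subtree x := by
  classical
  intro p
  exact p.support_takeUntil_subset_support (hz p) (hy _)

variable (hm : m.IsMatching)
include hm

/-- Besides its mate, the only neighbour of `x` in the skeleton is its own vertex. A walk avoiding
the edge at `x` thus enters and leaves `x` through the same vertex, and such visits can be cut out.
-/
theorem IsMatching.subtree_eq (ht : m.IsTree) {x : Pearl m.word} (hxr : x ≠ m.root)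
    (hr : m.root ∉ m.farSide x (m.mate x)) :
    m.subtree x = insert x (m.farSide x (m.mate x)) := by
  refine Set.Subset.antisymm ?_ (Set.insert_subset (mem_subtree_self x)
    (farSide_subset_subtree hr))
  intro z hz
  by_contra hc
  rw [Set.mem_insert_iff, not_or] at hc
  have hcov := reachable_deleteEdges_or ht.connected x (m.mate x)
  have hadj : ∀ a, (m.skeleton.deleteEdges {s(.inr x, .inr (m.mate x))}).Adj (.inr x) a →
      a = .inl x.1 := by
    intro a ha
    rw [SimpleGraph.deleteEdges_adj, Set.mem_singleton_iff] at ha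
    rcases a with v | u
    · rw [skeleton_adj_inl.1 ha.1.symm]
    · rw [hm.mate_eq (hm.skeleton_adj_inr.1 ha.1)] at ha
      exact (ha.2 rfl).elim
  have hrz : (m.skeleton.deleteEdges {s(.inr x, .inr (m.mate x))}).Reachable (.inr m.root)
      (.inr z) :=
    ((hcov _).resolve_right hr).symm.trans ((hcov _).resolve_right hc.2)
  -- The second alternative describes a walk that is just visiting `x`; it remembers a way to the
  -- vertex of `x` that avoids `x`.
  have key : ∀ a b, (m.skeleton.deleteEdges {s(.inr x, .inr (m.mate x))}).Walk a b →
      ((∃ p : m.skeleton.Walk (.inr m.root) a, .inr x ∉ p.support) ∨ a = .inr x ∧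
        ∃ p : m.skeleton.Walk (.inr m.root) (.inl x.1), .inr x ∉ p.support) →
      ((∃ p : m.skeleton.Walk (.inr m.root) b, .inr x ∉ p.support) ∨ b = .inr x ∧
        ∃ p : m.skeleton.Walk (.inr m.root) (.inl x.1), .inr x ∉ p.support) := by
    intro a b p
    induction p with
    | nil => exact id
    | @cons a b _ h _ ih =>
      intro hab
      apply ih
      rcases hab with ⟨p, hp⟩ | ⟨rfl, hp⟩
      · by_cases hb : b = .inr x
        · right
          subst hb
          obtain rfl := hadj _ h.symm
          exact ⟨rfl, p, hp⟩
        · left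
          refine ⟨p.concat (SimpleGraph.deleteEdges_le _ h), ?_⟩
          rw [SimpleGraph.Walk.support_concat]
          simp only [List.mem_append, List.mem_singleton, not_or]
          exact ⟨hp, fun h => hb h.symm⟩
      · left
        rw [hadj _ h]
        exact hp
  obtain ⟨p⟩ := hrz
  rcases key _ _ p (.inl ⟨.nil, by simpa using hxr⟩) with ⟨q, hq⟩ | ⟨h, -⟩
  · exact hq (hz q)
  · exact hc.1 (Sum.inr_injective h)

theorem IsMatching.incidentToOneEdge {x : Pearl m.word} (h : ¬ m.IsFree x) :
    m.IncidentToOneEdge x := by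
  obtain ⟨y, hy⟩ := not_forall_not.1 h
  rcases hy with hy | hy
  · refine ⟨(x, y), ⟨hy, .inl rfl⟩, ?_⟩
    rintro ⟨u, v⟩ ⟨huv, rfl | rfl⟩
    · exact Prod.ext rfl (hm.right_unique huv hy)
    · exact (hm.not_owner huv (hm.owner hy)).elim
  · refine ⟨(y, x), ⟨hy, .inr rfl⟩, ?_⟩
    rintro ⟨u, v⟩ ⟨huv, rfl | rfl⟩
    · exact (hm.not_owner hy (hm.owner huv)).elim
    · exact Prod.ext (hm.left_unique huv hy) rfl

theorem IsMatching.incidentToAtMostOneEdge (x : Pearl m.word) : m.IncidentToAtMostOneEdge x := by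
  intro e e' h h'
  have hf : ¬ m.IsFree x := by
    intro hf
    rcases h.2 with h2 | h2
    · exact hf e.2 (.inl (h2 ▸ h.1))
    · exact hf e.1 (.inr (h2 ▸ h.1))
  exact (hm.incidentToOneEdge hf).unique h h'

end PearlGraph

/-! ### Exchanging the edges of the diamonds -/

/-- The diamonds. -/
def diamonds {V : Type*} (w : V → List Letter) : Set (Pearl w) := {x | x.kind = .diamond}

/-- The triangles. -/
def triangles {V : Type*} (w : V → List Letter) : Set (Pearl w) := {x | x.kind = .triangle}

/-- The edges in which the edge at each diamond `x` is replaced by one to `a x`. -/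
def exchangeEdge {V : Type*} {w : V → List Letter} (E : Pearl w → Pearl w → Prop)
    (a : Pearl w → Pearl w) (x y : Pearl w) : Prop :=
  (E x y ∧ x ∉ diamonds w) ∨ (x ∈ diamonds w ∧ y = a x)

namespace PearlGraph

variable {V : Type*} {w : V → List Letter} {E : Pearl w → Pearl w → Prop} {r : Pearl w}
  {a : Pearl w → Pearl w}

theorem isOwner_of_mem_diamonds {x : Pearl w} (h : x ∈ diamonds w) : x.IsOwner := .inr h

/-- The diamonds may be joined by new edges to free non-owners given by `a`. -/
structure Exchangeable (E : Pearl w → Pearl w → Prop) (r : Pearl w) (a : Pearl w → Pearl w) :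
    Prop where
  matching : (mk w E r).IsMatching
  injOn : Set.InjOn a (diamonds w)
  not_owner : ∀ x ∈ diamonds w, ¬ (a x).IsOwner
  free : ∀ x ∈ diamonds w, (mk w E r).IsFree (a x)

namespace Exchangeable

variable (h : Exchangeable E r a)
include h

theorem isMatching : (PearlGraph.mk w (exchangeEdge E a) r).IsMatching where
  owner := by
    rintro x y (h' | h')
    exacts [h.matching.owner h'.1, .inr h'.1]
  not_owner := by
    rintro x y (h' | ⟨h', rfl⟩)
    exacts [h.matching.not_owner h'.1, h.not_owner x h']
  exists_edge := by
    intro x hx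
    by_cases hd : x ∈ diamonds w
    · exact ⟨a x, .inr ⟨hd, rfl⟩⟩
    · obtain ⟨y, hy⟩ := h.matching.exists_edge hx
      exact ⟨y, .inl ⟨hy, hd⟩⟩
  right_unique := by
    rintro x y y' (h1 | h1) (h2 | h2)
    · exact h.matching.right_unique h1.1 h2.1
    · exact (h1.2 h2.1).elim
    · exact (h2.2 h1.1).elim
    · rw [h1.2, h2.2]
  left_unique := by
    rintro x x' y (h1 | h1) (h2 | h2)
    · exact h.matching.left_unique h1.1 h2.1
    · exact (h.free x' h2.1 x (.inr (h2.2 ▸ h1.1))).elim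
    · exact (h.free x h1.1 x' (.inr (h1.2 ▸ h2.1))).elim
    · exact h.injOn h1.1 h2.1 (h1.2 ▸ h2.2)

theorem mate_diamond {x : Pearl w} (hx : x ∈ diamonds w) :
    (PearlGraph.mk w (exchangeEdge E a) r).mate x = a x :=
  h.isMatching.mate_eq (.inl (.inr ⟨hx, rfl⟩))

theorem mate_apply {x : Pearl w} (hx : x ∈ diamonds w) :
    (PearlGraph.mk w (exchangeEdge E a) r).mate (a x) = x :=
  h.isMatching.mate_eq (.inr (.inr ⟨hx, rfl⟩))

theorem free_mate {x : Pearl w} (hx : x ∈ diamonds w) :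
    (PearlGraph.mk w (exchangeEdge E a) r).IsFree ((PearlGraph.mk w E r).mate x) := by
  have he := h.matching.edge_mate (isOwner_of_mem_diamonds hx)
  rintro u ((h1 | h1) | (h1 | h1))
  · exact h.matching.not_owner he (h.matching.owner h1.1)
  · exact h.matching.not_owner he (isOwner_of_mem_diamonds h1.1)
  · exact h1.2 (h.matching.left_unique he h1.1 ▸ hx)
  · exact h.free u h1.1 x (.inr (h1.2 ▸ he))

/-- Away from the diamonds and the ends of chords and arcs, both graphs have the same edges. This
makes the remaining corners neutral in the exchange. -/
theorem mate_mate_eq {z : Pearl w} (hz : z ∉ diamonds w) (ha : ∀ x ∈ diamonds w, a x ≠ z)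
    (hc : ∀ x ∈ diamonds w, (PearlGraph.mk w E r).mate x ≠ z) :
    (PearlGraph.mk w (exchangeEdge E a) r).mate ((PearlGraph.mk w E r).mate z) = z := by
  by_cases hf : (PearlGraph.mk w E r).IsFree z
  · rw [mate_of_isFree hf]
    refine mate_of_isFree ?_
    rintro u ((h1 | h1) | (h1 | h1))
    · exact hf u (.inl h1.1)
    · exact hz h1.1
    · exact hf u (.inr h1.1)
    · exact ha u h1.1 h1.2.symm
  · obtain ⟨u, hu⟩ := not_forall_not.1 hf
    rw [h.matching.mate_eq hu]
    rcases hu with hu | hu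
    · exact h.isMatching.mate_eq (.inr (.inl ⟨hu, hz⟩))
    · exact h.isMatching.mate_eq (.inl (.inl ⟨hu, fun h' => hc u h' (h.matching.mate_eq (.inl hu))⟩))

/-- The number of edges is unchanged, so a tree is obtained once the ends of each deleted edge are
connected; the stretch of the new contour between them does this. -/
theorem isTree_and_nestedWalk [Finite V] (ht : (PearlGraph.mk w E r).IsTree)
    {s : Equiv.Perm (Pearl w)} (hs : IsRotation s.symm) {step step' : Pearl w → Pearl w}
    (hstep : ∀ z, step z = s ((PearlGraph.mk w E r).mate z))
    (hstep' : ∀ z, step' z = s.symm ((PearlGraph.mk w (exchangeEdge E a) r).mate z))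
    {R : Pearl w → Pearl w → Prop} (hR : WellFounded R) {L N' : Pearl w → Set (Pearl w)}
    (hL : ∀ x ∈ diamonds w, ∀ z ∈ L x,
      (∃ y ∈ diamonds w, (PearlGraph.mk w E r).mate y = z ∧ R y x ∧ N' y ⊆ N' x) ∨
      ((PearlGraph.mk w (exchangeEdge E a) r).mate ((PearlGraph.mk w E r).mate z) = z ∧ (PearlGraph.mk w E r).mate z ∈ N' x))
    (hlev : ∀ x ∈ diamonds w, ∃ n, LevelWalk step (L x) (N' x) (diamonds w) a (step x) n ∧
      step^[n + 1] x = a x) :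
    (PearlGraph.mk w (exchangeEdge E a) r).IsTree ∧ ∀ x ∈ diamonds w, ∃ t,
      NestedWalk step' (N' x) (diamonds w) (PearlGraph.mk w E r).mate (step' x) t ∧
        step'^[t + 1] x = (PearlGraph.mk w E r).mate x := by
  have hmm : Function.Involutive (PearlGraph.mk w E r).mate := h.matching.mate_mate
  let ρ : Equiv.Perm (Pearl w) := hmm.toPerm.trans s
  have hρ : ⇑ρ = step := funext fun z => (hstep z).symm
  have hρ' : ∀ z, ρ.symm z = (PearlGraph.mk w E r).mate (s.symm z) := fun z => rfl
  have hwalk : ∀ x ∈ diamonds w, ∃ t,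
      NestedWalk step' (N' x) (diamonds w) (PearlGraph.mk w E r).mate (step' x) t ∧
        step'^[t + 1] x = (PearlGraph.mk w E r).mate x := by
    refine exists_nestedWalk_exchange ρ (ma := (PearlGraph.mk w (exchangeEdge E a) r).mate)
      (mc := (PearlGraph.mk w E r).mate) (fun z => ?_) (fun x hx => ⟨rfl, hmm x, ?_⟩)
      (fun x hx => ⟨h.mate_diamond hx, h.mate_apply hx, ?_⟩) hR hL ?_
    -- Since `ρ⁻¹` is the old mate after `s⁻¹`, applying the old mate once more leaves `s⁻¹` after
    -- the new mate.
    · rw [hρ', hmm, hstep']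
    · exact mate_of_isFree (h.free x hx)
    · exact mate_of_isFree (h.free_mate hx)
    · rw [hρ]
      exact hlev
  refine ⟨?_, hwalk⟩
  rw [h.isMatching.isTree_iff]
  refine ⟨skeleton_connected_of_reachable ht.connected fun x y hxy => ?_,
    (h.matching.isTree_iff.1 ht).2⟩
  by_cases hx : x ∈ diamonds w
  · obtain ⟨t, -, h2⟩ := hwalk x hx
    rw [h.matching.mate_eq (.inl hxy)] at h2
    rw [← h2]
    exact h.isMatching.reachable_iterate hs hstep' x (t + 1)
  · exact (h.isMatching.skeleton_adj_inr.2 (.inl (.inl ⟨hxy, hx⟩))).reachable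

end Exchangeable

end PearlGraph

end Rewiring

namespace Rewiring
namespace PearlGraph

/-! ### Rewiring of non-negative trees -/

section QTree

variable {V : Type*} {Q : Set (List Letter)} {m : PearlGraph V} (h : m.IsQTree Q)
include h

theorem IsQTree.isMatching : m.IsMatching where
  owner hxy := (h.edge_kind _ _ hxy).1
  not_owner hxy ho := by
    have := (h.edge_kind _ _ hxy).2
    rcases ho with ho | ho <;> rw [this] at ho <;> cases ho
  exists_edge {x} hx := by
    have h1 : x ≠ m.root := by
      rintro rfl
      rcases hx with hx | hx <;> rw [h.root_kind] at hx <;> cases hx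
    have h2 : x.kind ≠ .triangle := by
      rcases hx with hx | hx <;> rw [hx] <;> simp
    obtain ⟨⟨u, v⟩, ⟨huv, rfl | rfl⟩, -⟩ := h.incident x h1 h2
    · exact ⟨v, huv⟩
    · have := (h.edge_kind _ _ huv).2
      rcases hx with hx | hx <;> rw [this] at hx <;> cases hx
  right_unique {x y y'} h1 h2 := by
    have hx := (h.edge_kind _ _ h1).1
    have h3 : x ≠ m.root := by
      rintro rfl
      exact h.root_free y (.inl h1)
    have h4 : x.kind ≠ .triangle := by
      rcases hx with hx | hx <;> rw [hx] <;> simp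
    exact congrArg Prod.snd ((h.incident x h3 h4).unique (y₁ := (x, y)) (y₂ := (x, y'))
      ⟨h1, .inl rfl⟩ ⟨h2, .inl rfl⟩)
  left_unique {x x' y} h1 h2 := by
    have h3 : y ≠ m.root := by
      rintro rfl
      exact h.root_free x (.inr h1)
    have h4 : y.kind ≠ .triangle := by
      rw [(h.edge_kind _ _ h1).2]
      simp
    exact congrArg Prod.fst ((h.incident y h3 h4).unique (y₁ := (x, y)) (y₂ := (x', y))
      ⟨h1, .inr rfl⟩ ⟨h2, .inr rfl⟩)

theorem IsQTree.mate_ne_root {x : Pearl m.word} (hx : x.IsOwner) : m.mate x ≠ m.root := by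
  intro h'
  exact h.root_free x (.inr (h' ▸ h.isMatching.edge_mate hx))

theorem IsQTree.mate_kind {x : Pearl m.word} (hx : x.IsOwner) : (m.mate x).kind = .square :=
  (h.edge_kind _ _ (h.isMatching.edge_mate hx)).2

/-- Edges point away from the root: the far side has one square more than owners, and the mates of
its owners together with `mate x` use up all these squares, leaving none for the free root. -/
theorem IsQTree.root_notMem_farSide [Finite V] {x : Pearl m.word} (hx : x.IsOwner) :
    m.root ∉ m.farSide x (m.mate x) := by
  intro hr
  have hm := h.isMatching
  have hF := hm.isFarSide h.isTree isRotation_succPerm (hm.mate_ne hx)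
  have h1 := hm.ncard_farSide h.isTree hx
  have h2 : ({z ∈ m.farSide x (m.mate x) | z.IsOwner}).ncard ≤
      ({z ∈ m.farSide x (m.mate x) | z.kind = .square} \ {m.mate x, m.root}).ncard := by
    refine Set.ncard_le_ncard_of_injOn m.mate ?_ ?_
    · rintro z ⟨hz, ho⟩
      have h3 : z ≠ x := fun h' => hF.notMem (h' ▸ hz)
      have h4 : z ≠ m.mate x := fun h' => hm.not_owner (hm.edge_mate hx) (h' ▸ ho)
      refine ⟨⟨(hF.mate_mem_iff z h3 h4).2 hz, h.mate_kind ho⟩, ?_⟩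
      rintro (h' | h')
      · apply h3
        rw [← hm.mate_mate z, h', hm.mate_mate]
      · exact h.mate_ne_root ho h'
    · intro z _ z' _ h'
      rw [← hm.mate_mate z, h', hm.mate_mate]
  have h5 : {m.mate x, m.root} ⊆ {z ∈ m.farSide x (m.mate x) | z.kind = .square} := by
    rintro z (rfl | rfl)
    · exact ⟨hF.mate_mem, h.mate_kind hx⟩
    · exact ⟨hr, h.root_kind⟩
  have h6 := Set.ncard_le_ncard h5
  rw [Set.ncard_sdiff h5, Set.ncard_pair (h.mate_ne_root hx)] at h2
  rw [Set.ncard_pair (h.mate_ne_root hx)] at h6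
  omega

end QTree

theorem excess_eq {V : Type*} (m : PearlGraph V) :
    m.excess = ((triangles m.word).ncard : ℤ) - ((diamonds m.word).ncard : ℤ) := by
  simp [excess, excessAt, subtree_root, triangles, diamonds]

theorem disjoint_diamonds_triangles {V : Type*} (w : V → List Letter) :
    Disjoint (diamonds w) (triangles w) := by
  rw [Set.disjoint_left]
  intro x (h : x.kind = _) (h' : x.kind = _)
  rw [h] at h'
  cases h'

theorem disjoint_union_compl {P : Type*} (A B : Set P) : Disjoint (A ∪ B)ᶜ A ∧ Disjoint (A ∪ B)ᶜ B :=
  ⟨(disjoint_compl_left (a := A ∪ B)).mono_right Set.subset_union_left,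
    (disjoint_compl_left (a := A ∪ B)).mono_right Set.subset_union_right⟩

section Rewire

variable {V : Type*} [Fintype V] {Q : Set (List Letter)} {w : V → List Letter}
  {E : Pearl w → Pearl w → Prop} {r : Pearl w}

/-- The subtree of `x` is `x` with its far side, so the sum over the tour is minus the excess at
`x`. -/
theorem IsNonnegQTree.walkSum_le (h : (PearlGraph.mk w E r).IsNonnegQTree Q) {x : Pearl w}
    (hx : x ∈ diamonds w) {T : ℕ} (hT0 : 0 < T)
    (hT : (PearlGraph.mk w E r).cwStep^[T] x = (PearlGraph.mk w E r).mate x)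
    (hTF : ∀ i, 0 < i → i ≤ T →
      (PearlGraph.mk w E r).cwStep^[i] x ∈ (PearlGraph.mk w E r).farSide x ((PearlGraph.mk w E r).mate x)) :
    walkSum (PearlGraph.mk w E r).cwStep (weight (diamonds w) (triangles w)) x (T + 1) ≤ 0 := by
  classical
  set m := PearlGraph.mk w E r
  have hm := h.isMatching
  have ho := isOwner_of_mem_diamonds hx
  have hF := hm.isFarSide h.isTree isRotation_succPerm (hm.mate_ne ho)
  have htr := hm.exists_iterate_eq h.isTree isRotation_succPerm (step := m.cwStep) fun _ => rfl
  have hxr : x ≠ m.root := fun h' => by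
    have := h.root_kind
    rw [← h', show x.kind = _ from hx] at this
    cases this
  rw [hF.walkSum_eq (step := m.cwStep) (fun _ => rfl) hm.mate_mate htr hT0 hT hTF, sum_weight]
  have h1 := h.nonneg x
  rw [excessAt, hm.subtree_eq h.isTree hxr (h.root_notMem_farSide ho)] at h1
  have h2 : {z ∈ insert x (m.farSide x (m.mate x)) | z.kind = .triangle} =
      m.farSide x (m.mate x) ∩ triangles w := by
    ext z
    constructor
    · rintro ⟨rfl | hz, hz'⟩
      · exact (Set.disjoint_left.1 (disjoint_diamonds_triangles w) hx hz').elim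
      · exact ⟨hz, hz'⟩
    · exact fun hz => ⟨.inr hz.1, hz.2⟩
  have h3 : {z ∈ insert x (m.farSide x (m.mate x)) | z.kind = .diamond} =
      insert x (m.farSide x (m.mate x) ∩ diamonds w) := by
    ext z
    constructor
    · rintro ⟨rfl | hz, hz'⟩
      · exact .inl rfl
      · exact .inr ⟨hz, hz'⟩
    · rintro (rfl | hz)
      · exact ⟨.inl rfl, hx⟩
      · exact ⟨.inr hz.1, hz.2⟩
  rw [h2, h3, Set.ncard_insert_of_notMem (fun h' => hF.notMem h'.1)] at h1
  rw [(isWeight_weight (disjoint_diamonds_triangles w)).out x hx]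
  push_cast at h1
  linarith

/-- The arcs are the first returns of the walk sum. That neutral corners of the new walks are not
free is what later excludes internal defects. -/
theorem IsNonnegQTree.exists_rewire (h : (PearlGraph.mk w E r).IsNonnegQTree Q) :
    ∃ a : Pearl w → Pearl w, Exchangeable E r a ∧ (∀ x ∈ diamonds w, a x ∈ triangles w) ∧
      (PearlGraph.mk w E r).rewire = PearlGraph.mk w (exchangeEdge E a) r ∧ (PearlGraph.mk w (exchangeEdge E a) r).IsTree ∧
      ∀ x ∈ diamonds w, ∃ t,
        NestedWalk (PearlGraph.mk w (exchangeEdge E a) r).ccwStep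
          {z | z ∉ diamonds w ∧ ¬ (PearlGraph.mk w (exchangeEdge E a) r).IsFree z} (diamonds w)
          (PearlGraph.mk w E r).mate ((PearlGraph.mk w (exchangeEdge E a) r).ccwStep x) t ∧
        (PearlGraph.mk w (exchangeEdge E a) r).ccwStep^[t + 1] x = (PearlGraph.mk w E r).mate x := by
  set m := PearlGraph.mk w E r with hm_def
  have hm := h.isMatching
  have hdt := disjoint_diamonds_triangles w
  have hinj := step_injective (step := m.cwStep) (s := succPerm w) (fun _ => rfl) hm.mate_mate
  have htr := hm.exists_iterate_eq h.isTree isRotation_succPerm (step := m.cwStep) fun _ => rfl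
  have hF := fun x (hx : x ∈ diamonds w) =>
    hm.isFarSide h.isTree isRotation_succPerm (hm.mate_ne (isOwner_of_mem_diamonds hx))
  have hFT := fun x (hx : x ∈ diamonds w) =>
    (hF x hx).exists_time (step := m.cwStep) (fun _ => rfl) hm.mate_mate
  have hw := isWeight_weight hdt
  set wt := weight (diamonds w) (triangles w)
  have hT : ∀ x ∈ diamonds w, ∃ T, walkSum m.cwStep wt x (T + 1) ≤ 0 := fun x hx => by
    obtain ⟨T, h0, h1, h2⟩ := hFT x hx
    exact ⟨T, h.walkSum_le hx h0 h1 h2⟩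
  set a := closingCorner m.cwStep wt
  have ha : ∀ x ∈ diamonds w, a x ∈ triangles w := fun x hx => closingCorner_mem hw hT hx
  have hwalk := fun x (hx : x ∈ diamonds w) => exists_nestedWalk_closingCorner hw hT hx
  have hainj : Set.InjOn a (diamonds w) := closingCorner_injOn hw hT hinj
  have hex : Exchangeable E r a :=
    { matching := hm
      injOn := hainj
      not_owner := by
        intro x hx ho
        have : (a x).kind = .triangle := ha x hx
        rcases ho with ho | ho <;> rw [this] at ho <;> cases ho
      free := fun x hx => h.triangle_free _ (ha x hx) }
  have hblue : m.blueEdges = {e | e.1 ∈ diamonds w ∧ e.2 = a e.1} :=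
    closurePairs_eq_graph hdt (disjoint_union_compl _ _).1 (disjoint_union_compl _ _).2 ha hainj
      (fun x hx => by
        obtain ⟨n, h1, -, h2⟩ := hwalk x hx
        exact ⟨n, h1, h2⟩)
  have hrew : m.rewire = PearlGraph.mk w (exchangeEdge E a) r := by
    change PearlGraph.mk w _ r = PearlGraph.mk w _ r
    congr 1
    ext x y
    change (E x y ∨ (x, y) ∈ m.blueEdges) ∧ ¬ (x.kind = .diamond ∧ y.kind = .square) ↔ _
    rw [hblue]
    constructor
    · rintro ⟨h1 | h1, h2⟩
      · exact .inl ⟨h1, fun h3 => h2 ⟨h3, (h.edge_kind x y h1).2⟩⟩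
      · exact .inr h1
    · rintro (⟨h1, h2⟩ | ⟨h1, rfl⟩)
      · exact ⟨.inl h1, fun h3 => h2 h3.1⟩
      · refine ⟨.inr ⟨h1, rfl⟩, fun h3 => ?_⟩
        have : (a x).kind = .triangle := ha x h1
        cases h3.2.symm.trans this
  obtain ⟨pos, -, -, hpos⟩ := exists_position hinj htr r
  have hposT : ∀ x ∈ diamonds w, ∀ T, (∀ i, 0 < i → i ≤ T →
      m.cwStep^[i] x ∈ m.farSide x (m.mate x)) → ∀ i ≤ T, pos (m.cwStep^[i] x) = pos x + i := by
    intro x hx T hTF i hi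
    apply hpos
    intro j h0 hj hj'
    apply h.root_notMem_farSide (isOwner_of_mem_diamonds hx)
    change r ∈ _
    rw [← hj']
    exact hTF j h0 (by omega)
  set m' := PearlGraph.mk w (exchangeEdge E a) r
  set J := closingTime m.cwStep wt
  set N := (diamonds w ∪ triangles w)ᶜ
  -- The arc of `x` closes within the tour of `x`. A chord ending strictly inside the arc therefore
  -- starts there as well, and by nesting the arc of `y` is shorter.
  have key : ∀ x ∈ diamonds w, ∀ i, 0 < i → i < J x → m.cwStep^[i] x ≠ r ∧
      ∀ y ∈ diamonds w, m.mate y = m.cwStep^[i] x → J y < J x := by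
    intro x hx i h0 hi
    obtain ⟨T, hT0, hT1, hTF⟩ := hFT x hx
    have hJT : J x ≤ T := closingTime_le (h.walkSum_le hx hT0 hT1 hTF)
    have hxF := hTF i h0 (by omega)
    refine ⟨fun hr => h.root_notMem_farSide (isOwner_of_mem_diamonds hx)
      (show r ∈ _ from hr ▸ hxF), fun y hy hyi => ?_⟩
    have hyx : y ≠ x := by
      rintro rfl
      rw [← hT1] at hyi
      have := (hF y hx).iterate_inj (step := m.cwStep) (fun _ => rfl) hm.mate_mate hTF le_rfl
        (show i ≤ T by omega) hyi
      omega
    have hyx' : y ≠ m.mate x := fun h' =>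
      hm.not_owner (hm.edge_mate (isOwner_of_mem_diamonds hx)) (h' ▸ isOwner_of_mem_diamonds hy)
    rw [← hyi, (hF x hx).mate_mem_iff y hyx hyx'] at hxF
    obtain ⟨i', h0', hi', rfl⟩ := (hF x hx).exists_time_of_mem (step := m.cwStep) (fun _ => rfl) hm.mate_mate htr
      hT0 hT1 hxF
    obtain ⟨S, hS0, hS1, hSF⟩ := hFT _ hy
    have h1 := hposT _ hy S hSF S le_rfl
    rw [hS1, hyi, hposT x hx T hTF i (by omega), hposT x hx T hTF i' hi'] at h1
    have h2 : i' + J (m.cwStep^[i'] x) < J x :=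
      add_closingTime_lt hw hT hx h0' (show i' < J x by omega) hy
    omega
  refine ⟨a, hex, ha, hrew, ?_⟩
  refine hex.isTree_and_nestedWalk h.isTree (s := succPerm w)
    isRotation_succPerm_symm (step := m.cwStep) (step' := m'.ccwStep) (fun _ => rfl) (fun _ => rfl)
    (R := fun y x => J y < J x) (measure J).wf
    (L := fun x => {z | z ∈ N ∧ ∃ i, 0 < i ∧ i < J x ∧ m.cwStep^[i] x = z})
    (N' := fun _ => {z | z ∉ diamonds w ∧ ¬ m'.IsFree z}) ?_ ?_
  · rintro x hx z ⟨hz, i, h0, hi, rfl⟩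
    obtain ⟨h1, h2⟩ := key x hx i h0 hi
    rw [Set.mem_compl_iff, Set.mem_union, not_or] at hz
    by_cases hy : ∃ y ∈ diamonds w, m.mate y = m.cwStep^[i] x
    · obtain ⟨y, hy, hyi⟩ := hy
      exact .inl ⟨y, hy, hyi, h2 y hy hyi, subset_rfl⟩
    · right
      push Not at hy
      have h3 := hex.mate_mate_eq hz.1 (fun y hy h' => hz.2 (h' ▸ ha y hy)) hy
      refine ⟨h3, ?_, ?_⟩
      · intro h4
        exact hy _ h4 (hm.mate_mate _)
      · intro hf
        have h4 := h3.symm.trans (mate_of_isFree hf)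
        have h5 : ¬ m.IsFree (m.cwStep^[i] x) := by
          obtain ⟨⟨u, v⟩, ⟨huv, h6 | h6⟩, -⟩ := h.incident (m.cwStep^[i] x) h1 hz.2
          · exact fun hf => hf v (.inl (h6 ▸ huv))
          · exact fun hf => hf u (.inr (h6 ▸ huv))
        obtain ⟨u, hu⟩ := not_forall_not.1 h5
        have h6 := hm.ne_of_joined hu
        rw [hm.mate_eq hu] at h4
        exact h6 h4
  · intro x hx
    obtain ⟨n, h1, h2, h3⟩ := hwalk x hx
    -- No height is needed here: arc length already decreases, so the constant height keeps all
    -- corners outside the inner arcs.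
    refine ⟨n, h1.toLevelWalk (e := fun _ => 0) (fun _ _ => rfl) (fun _ _ _ _ _ _ => rfl) ?_ ?_,
      h3⟩
    · intro i hi hi' _
      exact ⟨hi', i + 1, by omega, by omega, rfl⟩
    · intro y hy _
      refine ⟨fun h' => Set.disjoint_left.1 hdt h' (ha y hy), fun hf => ?_⟩
      exact hf y (.inr (.inr ⟨hy, rfl⟩))

theorem IsNonnegQTree.isBalancedCompanionTree_rewire {k : ℕ} (h : (PearlGraph.mk w E r).IsNonnegQTree Q)
    (hk : (PearlGraph.mk w E r).excess = k) :
    (PearlGraph.mk w E r).rewire.IsBalancedCompanionTree Q k ∧ (PearlGraph.mk w E r).rewire.invRewire = PearlGraph.mk w E r := by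
  obtain ⟨a, hex, ha, hrew, htree, hwalk⟩ := h.exists_rewire
  rw [hrew]
  have hm := h.isMatching
  have hm' := hex.isMatching
  set m := PearlGraph.mk w E r with hmdef
  set m' := PearlGraph.mk w (exchangeEdge E a) r with hm'def
  have hrk : r.kind = .square := h.root_kind
  have hmk : ∀ x ∈ diamonds w, (m.mate x).kind = .square := fun x hx =>
    h.mate_kind (isOwner_of_mem_diamonds hx)
  have hrfree : m'.IsFree r := by
    rintro u ((h1 | h1) | (h1 | h1))
    · exact h.root_free u (.inl h1.1)
    · exact absurd (hrk.symm.trans h1.1) (by simp)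
    · exact h.root_free u (.inr h1.1)
    · have := ha u h1.1
      rw [← h1.2] at this
      exact absurd (hrk.symm.trans this) (by simp)
  have hred : m'.redEdges = {e | e.1 ∈ diamonds w ∧ e.2 = m.mate e.1} := by
    refine closurePairs_eq_graph (N := {z | z ∉ diamonds w ∧ ¬ m'.IsFree z}) ?_ ?_ ?_ ?_ ?_ hwalk
    · rw [Set.disjoint_left]
      intro x h1 h2
      cases h2.1.symm.trans h1
    · rw [Set.disjoint_left]
      exact fun x h1 h2 => h1.1 h2
    · rw [Set.disjoint_left]
      exact fun x h1 h2 => h1.2 h2.2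
    · exact fun x hx => ⟨hmk x hx, hex.free_mate hx⟩
    · intro x _ y _ hxy
      rw [← hm.mate_mate x, hxy, hm.mate_mate]
  have hinv : m'.invRewire = m := by
    change PearlGraph.mk w _ r = PearlGraph.mk w _ r
    congr 1
    ext x y
    change (exchangeEdge E a x y ∨ (x, y) ∈ m'.redEdges) ∧
      ¬ (x.kind = .diamond ∧ y.kind = .triangle) ↔ _
    rw [hred]
    constructor
    · rintro ⟨(h1 | h1) | h1, h2⟩
      · exact h1.1
      · exact (h2 ⟨h1.1, h1.2 ▸ ha x h1.1⟩).elim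
      · have := hm.edge_mate (isOwner_of_mem_diamonds h1.1)
        rwa [← h1.2] at this
    · intro h1
      refine ⟨?_, fun h2 => ?_⟩
      · by_cases hx : x ∈ diamonds w
        · exact .inr ⟨hx, (hm.mate_eq (.inl h1)).symm⟩
        · exact .inl (.inl ⟨h1, hx⟩)
      · exact absurd ((h.edge_kind x y h1).2.symm.trans h2.2) (by simp)
  have hdef : m'.defects = triangles w \ a '' diamonds w := by
    ext z
    constructor
    · rintro ⟨h1, -, h3⟩
      refine ⟨h1, ?_⟩
      rintro ⟨x, hx, rfl⟩
      exact h3 x (.inr (.inr ⟨hx, rfl⟩))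
    · rintro ⟨h1, h2⟩
      refine ⟨h1, ?_, ?_⟩
      · intro h'
        cases hrk.symm.trans ((congrArg Pearl.kind h').symm.trans h1)
      · rintro u ((h3 | h3) | (h3 | h3))
        · exact h.triangle_free z h1 u (.inl h3.1)
        · exact Set.disjoint_left.1 (disjoint_diamonds_triangles w) h3.1 h1
        · exact h.triangle_free z h1 u (.inr h3.1)
        · exact h2 ⟨u, h3.1, h3.2.symm⟩
  -- Under a restored red edge there are only diamonds, squares that end red edges, and corners that
  -- are not free.
  have hint : m'.internalDefects = ∅ := by
    rw [Set.eq_empty_iff_forall_notMem]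
    rintro z ⟨⟨hz1, -, hz2⟩, ⟨x, y⟩, hxy, j, hj, hj', i, hi0, hij, rfl⟩
    rw [hred] at hxy
    obtain ⟨hx, rfl⟩ : x ∈ diamonds w ∧ y = m.mate x := hxy
    obtain ⟨t, h1, h2⟩ := hwalk x hx
    have hjt : j ≤ t + 1 := by
      by_contra hc
      exact hj' (t + 1) (by omega) (by omega) h2
    obtain ⟨i, rfl⟩ : ∃ i', i = i' + 1 := ⟨i - 1, by omega⟩
    rcases h1.iterate_mem i (by omega) with h3 | h3 | ⟨y, hy, h3⟩
    · exact h3.2 hz2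
    · exact Set.disjoint_left.1 (disjoint_diamonds_triangles w) h3 hz1
    · exact absurd (hz1.symm.trans ((congrArg Pearl.kind h3).trans (hmk y hy))) (by simp)
  refine ⟨{ word_mem := h.word_mem, edge_kind := ?_, root_free := hrfree, incident := ?_,
            incident_le := fun x _ => hm'.incidentToAtMostOneEdge x, isTree := htree,
            balanced := ⟨hrk, ?_⟩, external := ?_, internal := hint }, hinv⟩
  · rintro x y (h1 | h1)
    · have := h.edge_kind x y h1.1
      exact .inl ⟨this.1.resolve_right h1.2, this.2⟩
    · exact .inr ⟨h1.1, h1.2 ▸ ha x h1.1⟩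
  · intro x _ hx
    refine hm'.incidentToOneEdge fun hf => ?_
    obtain ⟨y, hy⟩ := hm'.exists_edge hx
    exact hf y (.inl hy)
  · intro x hx
    rw [hred] at hx
    exact h.mate_ne_root (isOwner_of_mem_diamonds hx.1) hx.2.symm
  · rw [externalDefects, hint, Set.sdiff_empty, hdef, Set.ncard_sdiff, hex.injOn.ncard_image]
    · rw [excess_eq] at hk
      change ((triangles w).ncard : ℤ) - ((diamonds w).ncard : ℤ) = k at hk
      omega
    · rintro _ ⟨x, hx, rfl⟩
      exact ha x hx

end Rewire

end PearlGraph
end Rewiring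

namespace Rewiring
namespace PearlGraph

/-! ### Inverse rewiring of balanced companion trees -/

section Companion

variable {V : Type*} {Q : Set (List Letter)} {m : PearlGraph V} (h : m.IsCompanionTree Q)
  (hr : m.root.kind = .square)
include h hr

theorem IsCompanionTree.isMatching : m.IsMatching where
  owner hxy := by
    rcases h.edge_kind _ _ hxy with h1 | h1
    exacts [.inl h1.1, .inr h1.1]
  not_owner hxy ho := by
    rcases h.edge_kind _ _ hxy with h1 | h1 <;> rcases ho with ho | ho <;>
      cases h1.2.symm.trans ho
  exists_edge {x} hx := by
    have h1 : x ≠ m.root := by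
      rintro rfl
      rcases hx with hx | hx <;> cases hr.symm.trans hx
    obtain ⟨⟨u, v⟩, ⟨huv, rfl | rfl⟩, -⟩ := h.incident x h1 hx
    · exact ⟨v, huv⟩
    · rcases h.edge_kind _ _ huv with h1 | h1 <;> rcases hx with ho | ho <;>
        cases h1.2.symm.trans ho
  right_unique {x y y'} h1 h2 := by
    have hx : x.kind = .bullet ∨ x.kind = .diamond := by
      rcases h.edge_kind _ _ h1 with h3 | h3
      exacts [.inl h3.1, .inr h3.1]
    have h3 : x ≠ m.root := by
      rintro rfl
      exact h.root_free y (.inl h1)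
    exact congrArg Prod.snd ((h.incident x h3 hx).unique (y₁ := (x, y)) (y₂ := (x, y'))
      ⟨h1, .inl rfl⟩ ⟨h2, .inl rfl⟩)
  left_unique {x x' y} h1 h2 := by
    have hy : y.kind = .square ∨ y.kind = .triangle := by
      rcases h.edge_kind _ _ h1 with h3 | h3
      exacts [.inl h3.2, .inr h3.2]
    exact congrArg Prod.fst (h.incident_le y hy (x, y) (x', y) ⟨h1, .inr rfl⟩ ⟨h2, .inr rfl⟩)

theorem IsCompanionTree.edge_mate_diamond {x : Pearl m.word} (hx : x ∈ diamonds m.word) :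
    m.mate x ∈ triangles m.word := by
  have := (h.isMatching hr).edge_mate (isOwner_of_mem_diamonds hx)
  rcases h.edge_kind _ _ this with h1 | h1
  · cases h1.1.symm.trans hx
  · exact h1.2

/-- In a set of pearls closed under the black edges, the bullets are as numerous as the squares
that are not free. -/
theorem IsCompanionTree.ncard_owner [Finite V] {S : Set (Pearl m.word)}
    (hS : ∀ z, z ∉ diamonds m.word → z ∉ triangles m.word → (m.mate z ∈ S ↔ z ∈ S))
    (hS' : {z ∈ S | z.kind = .square}.ncard = {z ∈ S | z.IsOwner}.ncard + 1) :
    (S ∩ {z | z.kind = .square ∧ m.IsFree z}).ncard = (S ∩ diamonds m.word).ncard + 1 := by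
  have hm := h.isMatching hr
  have h1 : {z ∈ S | z.kind = .bullet}.ncard =
      {z ∈ S | z.kind = .square ∧ ¬ m.IsFree z}.ncard := by
    refine Set.ncard_congr (fun z _ => m.mate z) ?_ ?_ ?_
    · rintro z ⟨hz, hz'⟩
      have he := hm.edge_mate (.inl hz')
      refine ⟨(hS z ?_ ?_).2 hz, ?_, fun hf => hf z (.inr he)⟩
      · intro (h' : z.kind = _)
        cases hz'.symm.trans h'
      · intro (h' : z.kind = _)
        cases hz'.symm.trans h'
      · rcases h.edge_kind _ _ he with h' | h'
        · exact h'.2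
        · cases hz'.symm.trans h'.1
    · intro z z' _ _ h'
      rw [← hm.mate_mate z, h', hm.mate_mate]
    · rintro z ⟨hz, hz', hf⟩
      refine ⟨m.mate z, ⟨(hS z ?_ ?_).2 hz, ?_⟩, hm.mate_mate z⟩
      · intro (h' : z.kind = _)
        cases hz'.symm.trans h'
      · intro (h' : z.kind = _)
        cases hz'.symm.trans h'
      · obtain ⟨u, hu⟩ := not_forall_not.1 hf
        rw [hm.mate_eq hu]
        rcases hu with hu | hu
        · rcases h.edge_kind _ _ hu with h' | h' <;> cases hz'.symm.trans h'.1
        · rcases h.edge_kind _ _ hu with h' | h'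
          · exact h'.1
          · cases hz'.symm.trans h'.2
  have h2 : {z ∈ S | z.kind = .square} =
      {z ∈ S | z.kind = .square ∧ ¬ m.IsFree z} ∪ (S ∩ {z | z.kind = .square ∧ m.IsFree z}) := by
    ext z
    simp only [Set.mem_union, Set.mem_inter_iff, Set.mem_ofPred_eq]
    tauto
  have h3 : {z ∈ S | z.IsOwner} = {z ∈ S | z.kind = .bullet} ∪ (S ∩ diamonds m.word) := by
    ext z
    simp [Pearl.IsOwner, diamonds, and_or_left]
  rw [h2, h3, Set.ncard_union_eq, Set.ncard_union_eq] at hS'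
  · omega
  · rw [Set.disjoint_left]
    rintro z ⟨-, hz⟩ ⟨-, hz'⟩
    cases hz.symm.trans hz'
  · rw [Set.disjoint_left]
    rintro z ⟨-, -, hz⟩ ⟨-, -, hz'⟩
    exact hz hz'

/-- The counterpart of non-negative excess: with free squares as closers, the tour of the far side
of `x` has sum zero, so the arc of `x` closes within it. -/
theorem IsCompanionTree.ncard_farSide [Finite V] {x : Pearl m.word} (hx : x ∈ diamonds m.word) :
    (m.farSide x (m.mate x) ∩ {z | z.kind = .square ∧ m.IsFree z}).ncard =
      (m.farSide x (m.mate x) ∩ diamonds m.word).ncard + 1 := by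
  have hm := h.isMatching hr
  have ho := isOwner_of_mem_diamonds hx
  have hF := hm.isFarSide h.isTree isRotation_succPerm (hm.mate_ne ho)
  refine h.ncard_owner hr (fun z h1 h2 => hF.mate_mem_iff z ?_ ?_) (hm.ncard_farSide h.isTree ho)
  · rintro rfl
    exact h1 hx
  · rintro rfl
    exact h2 (h.edge_mate_diamond hr hx)

theorem IsCompanionTree.ncard_free_square [Finite V] :
    {z : Pearl m.word | z.kind = .square ∧ m.IsFree z}.ncard = (diamonds m.word).ncard + 1 := by
  have hm := h.isMatching hr
  have := h.ncard_owner hr (S := Set.univ) (by simp) ?_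
  · simpa using this
  · have := (hm.isTree_iff.1 h.isTree).2
    rw [← ncard_square (word := m.word)] at this
    simpa using this.symm

end Companion

section InvRewire

variable {V : Type*} [Fintype V] {Q : Set (List Letter)} {w : V → List Letter}
  {E : Pearl w → Pearl w → Prop} {r : Pearl w} {k : ℕ}

theorem iterate_height {P : Type*} {step : P → P} {e wt : P → ℤ}
    (he : ∀ z, e (step z) = e z + wt z) (x : P) (n : ℕ) :
    e (step^[n] x) = e x + walkSum step wt x n := by
  induction n with
  | zero => simp [walkSum_zero]
  | succ n ih => rw [Function.iterate_succ_apply', he, ih, walkSum_succ, add_assoc]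

/-- The root may lie in the far side of a blue edge, so the induction runs on a height. The
condition `z ≠ a x` on neutral corners later places the former triangle of `x` in the subtree of
`x`. -/
theorem IsBalancedCompanionTree.exists_invRewire
    (h : (PearlGraph.mk w E r).IsBalancedCompanionTree Q k) :
    ∃ a : Pearl w → Pearl w, Exchangeable E r a ∧
      (∀ x ∈ diamonds w, (a x).kind = .square ∧ a x ≠ r) ∧
      (PearlGraph.mk w E r).invRewire = PearlGraph.mk w (exchangeEdge E a) r ∧
      (PearlGraph.mk w (exchangeEdge E a) r).IsTree ∧
      ∀ x ∈ diamonds w, ∃ t,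
        NestedWalk (PearlGraph.mk w (exchangeEdge E a) r).cwStep
          {z | z ∉ diamonds w ∧ z ∉ triangles w ∧ z ≠ a x} (diamonds w)
          (PearlGraph.mk w E r).mate ((PearlGraph.mk w (exchangeEdge E a) r).cwStep x) t ∧
        (PearlGraph.mk w (exchangeEdge E a) r).cwStep^[t + 1] x =
          (PearlGraph.mk w E r).mate x := by
  classical
  set m := PearlGraph.mk w E r with hm_def
  have hrk : m.root.kind = .square := h.balanced.1
  have hc : m.IsCompanionTree Q := h.toIsCompanionTree
  have hm := hc.isMatching hrk
  have hmt := fun x (hx : x ∈ diamonds w) => hc.edge_mate_diamond hrk hx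
  have hdt := disjoint_diamonds_triangles w
  have hinj := step_injective (step := m.ccwStep) (s := (succPerm w).symm) (fun _ => rfl)
    hm.mate_mate
  have htr := hm.exists_iterate_eq h.isTree isRotation_succPerm_symm (step := m.ccwStep)
    fun _ => rfl
  have hF := fun x (hx : x ∈ diamonds w) =>
    hm.isFarSide h.isTree isRotation_succPerm_symm (hm.mate_ne (isOwner_of_mem_diamonds hx))
  have hFT := fun x (hx : x ∈ diamonds w) =>
    (hF x hx).exists_time (step := m.ccwStep) (fun _ => rfl) hm.mate_mate
  let sq : Set (Pearl w) := {z | z.kind = .square ∧ m.IsFree z}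
  have hrsq : r ∈ sq := ⟨hrk, h.root_free⟩
  have hds : Disjoint (diamonds w) sq := by
    rw [Set.disjoint_left]
    intro z hz hz'
    cases hz'.1.symm.trans hz
  have hts : Disjoint (triangles w) sq := by
    rw [Set.disjoint_left]
    intro z hz hz'
    cases hz'.1.symm.trans hz
  have hw := isWeight_weight hds
  set wt := weight (diamonds w) sq with hwt
  have hsum : ∀ x ∈ diamonds w, ∀ T, 0 < T → m.ccwStep^[T] x = m.mate x →
      (∀ i, 0 < i → i ≤ T → m.ccwStep^[i] x ∈ m.farSide x (m.mate x)) → ∀ wt',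
      walkSum m.ccwStep wt' x (T + 1) = wt' x + ∑ z with z ∈ m.farSide x (m.mate x), wt' z :=
    fun x hx T h0 h1 h2 wt' =>
      (hF x hx).walkSum_eq (step := m.ccwStep) (fun _ => rfl) hm.mate_mate htr h0 h1 h2 wt'
  have hT0 : ∀ x ∈ diamonds w, ∀ T, 0 < T → m.ccwStep^[T] x = m.mate x →
      (∀ i, 0 < i → i ≤ T → m.ccwStep^[i] x ∈ m.farSide x (m.mate x)) →
      walkSum m.ccwStep wt x (T + 1) ≤ 0 := by
    intro x hx T h0 h1 h2
    have := hc.ncard_farSide hrk hx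
    rw [hsum x hx T h0 h1 h2, hw.out x hx, hwt, sum_weight]
    change (m.farSide x (m.mate x) ∩ sq).ncard = (m.farSide x (m.mate x) ∩ diamonds w).ncard + 1
      at this
    rw [this]
    push_cast
    linarith
  have hT : ∀ x ∈ diamonds w, ∃ T, walkSum m.ccwStep wt x (T + 1) ≤ 0 := fun x hx => by
    obtain ⟨T, h0, h1, h2⟩ := hFT x hx
    exact ⟨T, hT0 x hx T h0 h1 h2⟩
  set a := closingCorner m.ccwStep wt
  set J := closingTime m.ccwStep wt
  have ha : ∀ x ∈ diamonds w, a x ∈ sq := fun x hx => closingCorner_mem hw hT hx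
  have hwalk : ∀ x ∈ diamonds w, ∃ n, NestedWalk m.ccwStep (diamonds w ∪ sq)ᶜ (diamonds w) a
      (m.ccwStep x) n ∧ n + 1 = J x ∧ m.ccwStep^[n + 1] x = a x :=
    fun x hx => exists_nestedWalk_closingCorner hw hT hx
  have hainj : Set.InjOn a (diamonds w) := closingCorner_injOn hw hT hinj
  have hex : Exchangeable E r a :=
    { matching := hm
      injOn := hainj
      not_owner := by
        intro x hx ho
        rcases ho with ho | ho <;> cases (ha x hx).1.symm.trans ho
      free := fun x hx => (ha x hx).2 }
  have hred : m.redEdges = {e | e.1 ∈ diamonds w ∧ e.2 = a e.1} :=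
    closurePairs_eq_graph hds (disjoint_union_compl _ _).1 (disjoint_union_compl _ _).2 ha hainj
      (fun x hx => by
        obtain ⟨n, h1, -, h2⟩ := hwalk x hx
        exact ⟨n, h1, h2⟩)
  have har : ∀ x ∈ diamonds w, a x ≠ r := by
    intro x hx hxr
    apply h.balanced.2 x
    rw [hred]
    exact ⟨hx, hxr.symm⟩
  have hrew : m.invRewire = PearlGraph.mk w (exchangeEdge E a) r := by
    change PearlGraph.mk w _ r = PearlGraph.mk w _ r
    congr 1
    ext x y
    change (E x y ∨ (x, y) ∈ m.redEdges) ∧ ¬ (x.kind = .diamond ∧ y.kind = .triangle) ↔ _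
    rw [hred]
    constructor
    · rintro ⟨h1 | h1, h2⟩
      · refine .inl ⟨h1, fun h3 => h2 ⟨h3, ?_⟩⟩
        have := hmt x h3
        rwa [hm.mate_eq (.inl h1)] at this
      · exact .inr h1
    · rintro (⟨h1, h2⟩ | ⟨h1, rfl⟩)
      · exact ⟨.inl h1, fun h3 => h2 h3.1⟩
      · exact ⟨.inr ⟨h1, rfl⟩, fun h3 => by cases (ha x h1).1.symm.trans h3.2⟩
  have hJT : ∀ x ∈ diamonds w, ∃ T, 0 < T ∧ J x ≤ T ∧ m.ccwStep^[T] x = m.mate x ∧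
      ∀ i, 0 < i → i ≤ T → m.ccwStep^[i] x ∈ m.farSide x (m.mate x) := by
    intro x hx
    obtain ⟨T, h0, h1, h2⟩ := hFT x hx
    exact ⟨T, h0, closingTime_le (hT0 x hx T h0 h1 h2), h1, h2⟩
  -- Every free square met on an arc is the end of an arc, and balance says that the root is not.
  have hrarc : ∀ x ∈ diamonds w, ∀ i, 0 < i → i ≤ J x → m.ccwStep^[i] x ≠ r := by
    intro x hx i h0 hi hir
    obtain ⟨n, h1, h2, h3⟩ := hwalk x hx
    obtain ⟨i, rfl⟩ : ∃ i', i = i' + 1 := ⟨i - 1, by omega⟩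
    rcases (show i ≤ n by omega).lt_or_eq with h4 | rfl
    · have h5 := h1.iterate_mem i h4
      rw [← Function.iterate_succ_apply, hir] at h5
      rcases h5 with h5 | h5 | ⟨y, hy, h5⟩
      · exact h5 (.inr hrsq)
      · exact Set.disjoint_left.1 hds h5 hrsq
      · exact har y hy h5.symm
    · exact har x hx (h3.symm.trans hir)
  -- the height at which the root is neutral
  have hd0 : Disjoint (diamonds w) (sq \ {r}) := hds.mono_right Set.sdiff_subset
  have hw0 := isWeight_weight hd0
  set wt0 := weight (diamonds w) (sq \ {r}) with hwt0
  have hsqcard : (sq \ {r}).ncard = (diamonds w).ncard := by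
    have := hc.ncard_free_square hrk
    rw [Set.ncard_sdiff_singleton_of_mem hrsq, show sq.ncard = _ from this]
    rfl
  obtain ⟨e, he⟩ := exists_height hinj htr wt0 (by
    have := sum_weight (diamonds w) (sq \ {r}) Set.univ
    simp only [Set.mem_univ, Finset.filter_true, Set.univ_inter] at this
    rw [hwt0, this, hsqcard, sub_self]) r
  have heN : ∀ z ∈ (diamonds w ∪ sq)ᶜ, e (m.ccwStep z) = e z := by
    intro z hz
    rw [he, hw0.neutral z fun h' => hz (h'.imp id fun h => h.1), add_zero]
  have hed : ∀ x ∈ diamonds w, e (m.ccwStep x) = e x + 1 := by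
    intro x hx
    rw [he, hw0.out x hx]
  have hea' : ∀ x ∈ diamonds w, e (m.ccwStep (a x)) = e (a x) - 1 := by
    intro x hx
    rw [he, hw0.inc _ ⟨ha x hx, har x hx⟩]
    rfl
  have hea : ∀ x ∈ diamonds w, ∀ n, NestedWalk m.ccwStep (diamonds w ∪ sq)ᶜ (diamonds w) a
      (m.ccwStep x) n → m.ccwStep^[n + 1] x = a x →
      e (m.ccwStep^[n + 1] x) = e (m.ccwStep x) → e (m.ccwStep (a x)) = e x := by
    intro x hx n _ h1 h2
    rw [hea' x hx, ← h1, h2, hed x hx]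
    ring
  have heax : ∀ x ∈ diamonds w, e (a x) = e x + 1 := by
    intro x hx
    obtain ⟨n, h1, -, h3⟩ := hwalk x hx
    have := h1.height_eq heN hea
    rw [← Function.iterate_succ_apply, h3] at this
    rw [this, hed x hx]
  -- The far side has one free square more than diamonds. This compensates the step up at `x`,
  -- unless the surplus square is neutralized because the root is among them.
  have hemate : ∀ x ∈ diamonds w,
      e (m.mate x) = e x + if r ∈ m.farSide x (m.mate x) then 1 else 0 := by
    intro x hx
    obtain ⟨T, h0, -, h1, h2⟩ := hJT x hx
    have h3 := iterate_height he x (T + 1)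
    have h4 := hc.ncard_farSide hrk hx
    change (m.farSide x (m.mate x) ∩ sq).ncard = (m.farSide x (m.mate x) ∩ diamonds w).ncard + 1
      at h4
    have h5 : m.mate x ∈ (diamonds w ∪ sq)ᶜ := by
      rintro (h' | h')
      · exact Set.disjoint_left.1 hdt h' (hmt x hx)
      · exact Set.disjoint_left.1 hts (hmt x hx) h'
    rw [Function.iterate_succ_apply', h1, heN _ h5, hsum x hx T h0 h1 h2, hw0.out x hx, hwt0,
      sum_weight, ← Set.inter_sdiff_assoc] at h3
    rw [h3]
    split_ifs with h6
    · rw [Set.ncard_sdiff_singleton_of_mem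
        (show r ∈ m.farSide x (m.mate x) ∩ sq from ⟨h6, hrsq⟩), h4]
      push_cast
      simp
    · rw [Set.sdiff_singleton_eq_self fun h' => h6 h'.1, h4]
      push_cast
      ring
  obtain ⟨pos, hpos1, hpos2, hpos3⟩ := exists_position hinj htr r
  -- Positions restart at the root: a tour that passes the root reaches the mate at a smaller
  -- position than that of `x`.
  have hposmate : ∀ x ∈ diamonds w, r ∈ m.farSide x (m.mate x) → pos (m.mate x) < pos x := by
    intro x hx hr
    obtain ⟨T, h0, -, h1, h2⟩ := hJT x hx
    obtain ⟨i, hi0, hi, hir⟩ := (hF x hx).exists_time_of_mem (step := m.ccwStep) (fun _ => rfl)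
      hm.mate_mate htr h0 h1 hr
    have h3 : m.ccwStep^[T - i] r = m.mate x := by
      rw [← hir, ← Function.iterate_add_apply, Nat.sub_add_cancel hi, h1]
    have h4 := hpos2 (T - i)
    rw [h3] at h4
    by_contra hlt
    have h5 := h2 (pos x + i) (by omega) (by omega)
    rw [Function.iterate_add_apply, hir, hpos1] at h5
    exact (hF x hx).notMem h5
  set m' := PearlGraph.mk w (exchangeEdge E a) r
  -- Higher diamonds are treated first, and at equal height those farther along the walk from the
  -- root.
  let R : Pearl w → Pearl w → Prop := fun y x => e x < e y ∨ (e x = e y ∧ pos x < pos y)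
  have hR : WellFounded R := by
    have : IsTrans _ R := ⟨by
      rintro x y z (h1 | h1) (h2 | h2)
      · exact .inl (h2.trans h1)
      · exact .inl (h2.1 ▸ h1)
      · exact .inl (h1.1 ▸ h2)
      · exact .inr ⟨h2.1.trans h1.1, h2.2.trans h1.2⟩⟩
    have : Std.Irrefl R := ⟨by
      rintro x (h1 | h1)
      · exact lt_irrefl _ h1
      · exact lt_irrefl _ h1.2⟩
    exact Finite.wellFounded_of_trans_of_irrefl R
  -- Here the absence of internal defects enters: a free triangle inside an arc would be enclosed by
  -- a red edge.
  have hnodef : ∀ x ∈ diamonds w, ∀ i, 0 < i → i < J x →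
      m.ccwStep^[i] x ∈ triangles w → ¬ m.IsFree (m.ccwStep^[i] x) := by
    intro x hx i h0 hi ht hf
    obtain ⟨T, hT0, hJT, h1, h2⟩ := hJT x hx
    have : m.ccwStep^[i] x ∈ m.internalDefects := by
      refine ⟨⟨ht, fun hr => ?_, hf⟩, (x, a x), ?_, J x, rfl, ?_, i, h0, hi, rfl⟩
      · exact hrarc x hx i h0 hi.le hr
      · rw [hred]
        exact ⟨hx, rfl⟩
      · intro j hj0 hj hj'
        have := (hF x hx).iterate_inj (step := m.ccwStep) (fun _ => rfl) hm.mate_mate h2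
          (show j ≤ T by omega) hJT hj'
        omega
    rw [h.internal] at this
    exact this
  -- The arcs jumped over from `x` start at height `e x + 1` and end at `e x + 2`, whereas `a x` has
  -- height `e x + 1`. The bound thus excludes `a x`, and it is inherited by detours, which start no
  -- lower than `x`.
  let N' : Pearl w → Set (Pearl w) := fun x => {z | z ∉ diamonds w ∧ z ∉ triangles w ∧
    ∀ y ∈ diamonds w, a y = z → e x + 2 ≤ e z}
  have hmain := hex.isTree_and_nestedWalk h.isTree (s := (succPerm w).symm)
    isRotation_succPerm (step := m.ccwStep) (step' := m'.cwStep) (fun _ => rfl) (fun _ => rfl)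
    hR (L := fun x => {z | z ∈ (diamonds w ∪ sq)ᶜ ∧ e z = e x + 1 ∧
      ∃ i, 0 < i ∧ i < J x ∧ m.ccwStep^[i] x = z}) (N' := N') ?_ ?_
  · refine ⟨a, hex, fun x hx => ⟨(ha x hx).1, har x hx⟩, hrew, hmain.1, fun x hx => ?_⟩
    obtain ⟨t, h1, h2⟩ := hmain.2 x hx
    refine ⟨t, h1.mono ?_, h2⟩
    rintro z ⟨h3, h4, h5⟩
    refine ⟨h3, h4, ?_⟩
    rintro rfl
    have := h5 x hx rfl
    rw [heax x hx] at this
    omega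
  · rintro x hx z ⟨hz, hze, i, h0, hi, rfl⟩
    by_cases hy : ∃ y ∈ diamonds w, m.mate y = m.ccwStep^[i] x
    · left
      obtain ⟨y, hy, hyi⟩ := hy
      have h1 := hemate y hy
      rw [hyi, hze, ← hyi] at h1
      have h2 : R y x := by
        -- If the root is across the edge of `y`, then `y` is level with `x` but comes after its own
        -- mate, hence after `x`. Otherwise `y` is one unit higher than `x`.
        split_ifs at h1 with h3
        · right
          refine ⟨by omega, ?_⟩
          have h4 := hposmate y hy h3
          rw [hyi, hpos3 x i fun j hj0 hj => hrarc x hx j hj0 (by omega)] at h4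
          omega
        · left
          omega
      refine ⟨y, hy, hyi, h2, ?_⟩
      rintro z ⟨h3, h4, h5⟩
      refine ⟨h3, h4, fun u hu huz => ?_⟩
      have := h5 u hu huz
      rcases h2 with h2 | h2 <;> omega
    · right
      push Not at hy
      have h3 := hex.mate_mate_eq (fun h' => hz (.inl h')) (fun y hy h' => hz (.inr (h' ▸ ha y hy)))
        hy
      refine ⟨h3, ?_, ?_, ?_⟩
      · intro h4
        exact hy _ h4 (hm.mate_mate _)
      · intro h4
        by_cases hf : m.IsFree (m.ccwStep^[i] x)
        · rw [mate_of_isFree hf] at h4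
          exact hnodef x hx i h0 hi h4 hf
        · obtain ⟨u, hu⟩ := not_forall_not.1 hf
          rw [hm.mate_eq hu] at h4
          rcases hu with hu | hu
          · rcases h.edge_kind _ _ hu with h5 | h5
            · cases h5.2.symm.trans h4
            · exact hz (.inl h5.1)
          · rcases h.edge_kind _ _ hu with h5 | h5
            · cases h5.1.symm.trans h4
            · cases h5.1.symm.trans h4
      · intro y hy' h4
        have h5 := mate_of_isFree (ha y hy').2
        rw [h4, hm.mate_mate] at h5
        refine (hz (.inr ?_)).elim
        rw [h5, ← h4]
        exact ha y hy'
  · intro x hx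
    obtain ⟨n, h1, h2, h3⟩ := hwalk x hx
    refine ⟨n, h1.toLevelWalk heN hea ?_ ?_, h3⟩
    · intro i hi h4 h5
      exact ⟨h4, h5.trans (hed x hx), i + 1, by omega, by omega, rfl⟩
    · intro y hy hye
      refine ⟨fun h' => Set.disjoint_left.1 hds h' (ha y hy),
        fun h' => Set.disjoint_left.1 hts h' (ha y hy), fun _ _ _ => ?_⟩
      rw [heax y hy, hye, hed x hx]
      omega

end InvRewire

end PearlGraph
end Rewiring

namespace Rewiring
namespace PearlGraph

/-! ### From balanced companion trees back to non-negative trees. -/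

section InvRewire

variable {V : Type*} [Fintype V] {Q : Set (List Letter)} {w : V → List Letter}
  {E : Pearl w → Pearl w → Prop} {r : Pearl w} {k : ℕ}

/-- Subtrees are nested, so `b` maps the diamonds of any subtree injectively to triangles of the
same subtree. -/
theorem nonneg_of_mem_subtree {V : Type*} [Finite V] {m : PearlGraph V}
    (b : Pearl m.word → Pearl m.word) (hb : Set.InjOn b (diamonds m.word))
    (hb' : ∀ x ∈ diamonds m.word, b x ∈ triangles m.word ∧ b x ∈ m.subtree x)
    (x : Pearl m.word) : 0 ≤ m.excessAt x := by
  rw [excessAt, sub_nonneg, Nat.cast_le]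
  refine Set.ncard_le_ncard_of_injOn b ?_ (hb.mono fun z hz => hz.2)
  rintro z ⟨h1, h2⟩
  exact ⟨mem_subtree_trans h1 (hb' z h2).2, (hb' z h2).1⟩

theorem IsBalancedCompanionTree.isNonnegQTree_invRewire
    (h : (PearlGraph.mk w E r).IsBalancedCompanionTree Q k) :
    (PearlGraph.mk w E r).invRewire.IsNonnegQTree Q ∧
      (PearlGraph.mk w E r).invRewire.excess = k ∧
      (PearlGraph.mk w E r).invRewire.rewire = PearlGraph.mk w E r := by
  obtain ⟨a, hex, ha, hrew, htree, hwalk⟩ := h.exists_invRewire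
  rw [hrew]
  have hrk : r.kind = .square := h.balanced.1
  have hc : (PearlGraph.mk w E r).IsCompanionTree Q := h.toIsCompanionTree
  have hm := hc.isMatching hrk
  have hm' := hex.isMatching
  have hmt := fun x (hx : x ∈ diamonds w) => hc.edge_mate_diamond hrk hx
  set m := PearlGraph.mk w E r with hmdef
  set m' := PearlGraph.mk w (exchangeEdge E a) r with hm'def
  have hminj : Set.InjOn m.mate (diamonds w) := by
    intro x _ y _ hxy
    rw [← hm.mate_mate x, hxy, hm.mate_mate]
  have hblack : ∀ x y, E x y → x ∉ diamonds w → x.kind = .bullet ∧ y.kind = .square := by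
    intro x y hxy hx
    rcases h.edge_kind x y hxy with h1 | h1
    · exact h1
    · exact (hx h1.1).elim
  have htfree : ∀ x : Pearl w, x.kind = .triangle → m'.IsFree x := by
    rintro x hx u ((h1 | h1) | (h1 | h1))
    · cases (hblack _ _ h1.1 h1.2).1.symm.trans hx
    · cases hx.symm.trans h1.1
    · cases (hblack _ _ h1.1 h1.2).2.symm.trans hx
    · cases hx.symm.trans ((congrArg Pearl.kind h1.2).trans (ha u h1.1).1)
  have hblue : m'.blueEdges = {e | e.1 ∈ diamonds w ∧ e.2 = m.mate e.1} := by
    refine closurePairs_eq_graph (N := (diamonds w ∪ triangles w)ᶜ)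
      (disjoint_diamonds_triangles w) (disjoint_union_compl _ _).1 (disjoint_union_compl _ _).2
      hmt hminj fun x hx => ?_
    obtain ⟨t, h1, h2⟩ := hwalk x hx
    exact ⟨t, h1.mono fun z hz h' => h'.elim hz.1 hz.2.1, h2⟩
  have hrewire : m'.rewire = m := by
    change PearlGraph.mk w _ r = PearlGraph.mk w _ r
    congr 1
    ext x y
    change (exchangeEdge E a x y ∨ (x, y) ∈ m'.blueEdges) ∧
      ¬ (x.kind = .diamond ∧ y.kind = .square) ↔ _
    rw [hblue]
    constructor
    · rintro ⟨(h1 | h1) | h1, h2⟩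
      · exact h1.1
      · refine (h2 ⟨h1.1, ?_⟩).elim
        rw [h1.2]
        exact (ha x h1.1).1
      · have := hm.edge_mate (isOwner_of_mem_diamonds h1.1)
        rwa [← h1.2] at this
    · intro h1
      refine ⟨?_, fun h2 => ?_⟩
      · by_cases hx : x ∈ diamonds w
        · exact .inr ⟨hx, (hm.mate_eq (.inl h1)).symm⟩
        · exact .inl (.inl ⟨h1, hx⟩)
      · have h3 := hmt x h2.1
        rw [hm.mate_eq (.inl h1)] at h3
        cases h2.2.symm.trans h3
  -- There is one free square more than diamonds, so the arcs use all free squares except the root.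
  have hsq : a '' diamonds w = {z : Pearl w | z.kind = .square ∧ m.IsFree z} \ {r} := by
    refine Set.eq_of_subset_of_ncard_le ?_ ?_
    · rintro _ ⟨x, hx, rfl⟩
      exact ⟨⟨(ha x hx).1, hex.free x hx⟩, (ha x hx).2⟩
    · rw [hex.injOn.ncard_image, Set.ncard_sdiff_singleton_of_mem
        (show r ∈ {z : Pearl w | z.kind = .square ∧ m.IsFree z} from ⟨hrk, h.root_free⟩)]
      have := hc.ncard_free_square hrk
      exact (Nat.sub_le_of_le_add this.le)
  have hQ : m'.IsQTree Q :=
    { word_mem := h.word_mem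
      edge_kind := by
        rintro x y (h1 | h1)
        · have := hblack x y h1.1 h1.2
          exact ⟨.inl this.1, this.2⟩
        · exact ⟨.inr h1.1, by rw [h1.2]; exact (ha x h1.1).1⟩
      root_kind := hrk
      root_free := by
        rintro u ((h1 | h1) | (h1 | h1))
        · exact h.root_free u (.inl h1.1)
        · cases hrk.symm.trans h1.1
        · exact h.root_free u (.inr h1.1)
        · exact (ha u h1.1).2 h1.2.symm
      triangle_free := htfree
      incident := by
        intro x hxr hxt
        refine hm'.incidentToOneEdge fun hf => ?_
        by_cases ho : x.IsOwner
        · obtain ⟨y, hy⟩ := hm'.exists_edge ho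
          exact hf y (.inl hy)
        have hxk : x.kind = .square := by
          rw [Pearl.IsOwner, not_or] at ho
          cases hk : x.kind
          · rfl
          · exact (ho.1 hk).elim
          · exact (ho.2 hk).elim
          · exact (hxt hk).elim
        by_cases hxf : m.IsFree x
        · have : x ∈ a '' diamonds w := by
            rw [hsq]
            exact ⟨⟨hxk, hxf⟩, hxr⟩
          obtain ⟨y, hy, rfl⟩ := this
          exact hf y (.inr (.inr ⟨hy, rfl⟩))
        · obtain ⟨u, hu | hu⟩ := not_forall_not.1 hxf
          · exact ho (hm.owner hu)
          · refine hf u (.inr (.inl ⟨hu, fun hud => ?_⟩))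
            have h3 := hmt u hud
            rw [hm.mate_eq (.inl hu)] at h3
            exact hxt h3
      isTree := htree }
  -- In the new tree the tour of the far side of `x` ends at `a x`. The walk from `x` to its former
  -- triangle avoids `a x`, so it stays within the tour.
  have hsub : ∀ x ∈ diamonds w, m.mate x ∈ m'.subtree x := by
    intro x hx
    have ho := isOwner_of_mem_diamonds hx
    have hF := hm'.isFarSide htree isRotation_succPerm (hm'.mate_ne ho)
    have htr := hm'.exists_iterate_eq htree isRotation_succPerm (step := m'.cwStep) fun _ => rfl
    refine farSide_subset_subtree (hQ.root_notMem_farSide ho) ?_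
    obtain ⟨T, h0, h1, h2⟩ := hF.exists_time (step := m'.cwStep) (fun _ => rfl) hm'.mate_mate
    obtain ⟨t, h3, h4⟩ := hwalk x hx
    rw [← h4]
    refine h2 _ (by omega) ?_
    by_contra hlt
    rw [hex.mate_diamond hx] at h1
    obtain ⟨T, rfl⟩ : ∃ T', T = T' + 1 := ⟨T - 1, by omega⟩
    have h5 := h3.iterate_mem T (by omega)
    rw [← Function.iterate_succ_apply, h1] at h5
    rcases h5 with h5 | h5 | ⟨y, hy, h5⟩
    · exact h5.2.2 rfl
    · cases (ha x hx).1.symm.trans h5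
    · have := hmt y hy
      rw [← h5] at this
      cases (ha x hx).1.symm.trans this
  refine ⟨⟨hQ, nonneg_of_mem_subtree m.mate hminj fun x hx => ⟨hmt x hx, hsub x hx⟩⟩, ?_, hrewire⟩
  have hdef : m.defects = triangles w \ m.mate '' diamonds w := by
    ext z
    constructor
    · rintro ⟨h1, -, h3⟩
      refine ⟨h1, ?_⟩
      rintro ⟨x, hx, rfl⟩
      exact h3 x (.inr (hm.edge_mate (isOwner_of_mem_diamonds hx)))
    · rintro ⟨h1, h2⟩
      refine ⟨h1, ?_, ?_⟩
      · intro h'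
        cases hrk.symm.trans ((congrArg Pearl.kind h').symm.trans h1)
      · rintro u (h3 | h3)
        · rcases h.edge_kind _ _ h3 with h4 | h4 <;> cases h4.1.symm.trans h1
        · rcases h.edge_kind _ _ h3 with h4 | h4
          · cases h4.2.symm.trans h1
          · exact h2 ⟨u, h4.1, hm.mate_eq (.inl h3)⟩
  have hext := h.external
  have hsubset : m.mate '' diamonds w ⊆ triangles w := by
    rintro _ ⟨x, hx, rfl⟩
    exact hmt x hx
  have hle := Set.ncard_le_ncard hsubset
  rw [externalDefects, h.internal, Set.sdiff_empty, hdef, Set.ncard_sdiff hsubset,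
    hminj.ncard_image] at hext
  rw [hminj.ncard_image] at hle
  rw [excess_eq]
  change ((triangles w).ncard : ℤ) - ((diamonds w).ncard : ℤ) = k
  omega

end InvRewire

end PearlGraph
end Rewiring

namespace Rewiring

/-! ### Invariance under isomorphism -/

theorem Pearl.ext_of_val {V : Type*} {word : V → List Letter} {x y : Pearl word} (h : x.1 = y.1)
    (h' : (x.2 : ℕ) = (y.2 : ℕ)) : x = y := by
  obtain ⟨v, i⟩ := x
  obtain ⟨u, j⟩ := y
  obtain rfl : v = u := h
  congr 1
  exact Fin.ext h'

theorem Pearl.kind_congr {V W : Type*} {word : V → List Letter} {word' : W → List Letter}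
    {x : Pearl word} {y : Pearl word'} (h : word x.1 = word' y.1)
    (h' : (x.2 : ℕ) = (y.2 : ℕ)) : x.kind = y.kind := by
  have key : ∀ (l l' : List Letter) (i : Fin (l.length + 1)) (j : Fin (l'.length + 1)),
      l = l' → (i : ℕ) = (j : ℕ) →
      (Fin.cases Kind.square (fun i => (l.get i).kind) i : Kind) =
        Fin.cases Kind.square (fun i => (l'.get i).kind) j := by
    rintro l _ i j rfl hij
    rw [Fin.ext hij]
  exact key _ _ _ _ h h'

/-! ### Transport of iterated matching along a bijection. -/

section ClosureEquiv

variable {P P' : Type*} {f : P ≃ P'} {step : P → P} {step' : P' → P'} {out inc : Set P}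
  {out' inc' : Set P'} (hs : ∀ x, step' (f x) = f (step x)) (ho : ∀ x, f x ∈ out' ↔ x ∈ out)
  (hi : ∀ x, f x ∈ inc' ↔ x ∈ inc)

include ho hi in
theorem apply_mem_unmatched {M : Set (P × P)} {M' : Set (P' × P')}
    (hM : ∀ x y, (f x, f y) ∈ M' ↔ (x, y) ∈ M) (x : P) :
    f x ∈ unmatched out' inc' M' ↔ x ∈ unmatched out inc M := by
  refine and_congr (or_congr (ho x) (hi x)) ⟨?_, ?_⟩
  · rintro h ⟨y, z⟩ hyz
    have := h _ ((hM y z).2 hyz)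
    simpa using this
  · rintro h ⟨y, z⟩ hyz
    obtain ⟨y, rfl⟩ := f.surjective y
    obtain ⟨z, rfl⟩ := f.surjective z
    have := h _ ((hM y z).1 hyz)
    simpa using this

include hs in
theorem iterate_apply_equiv (n : ℕ) (x : P) : step'^[n] (f x) = f (step^[n] x) :=
  (Function.Semiconj.iterate_right (fun x => (hs x).symm) n x).symm

include hs ho hi in
theorem apply_mem_closurePairs (x y : P) :
    (f x, f y) ∈ closurePairs step' out' inc' ↔ (x, y) ∈ closurePairs step out inc := by
  rw [mem_closurePairs, mem_closurePairs]
  refine exists_congr fun n => ?_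
  induction n generalizing x y with
  | zero => exact Iff.rfl
  | succ n ih =>
    rw [stagePairs_succ, stagePairs_succ]
    refine or_congr (ih x y) ?_
    have hu := apply_mem_unmatched ho hi ih
    refine and_congr (ho x) (and_congr (hu x) (and_congr (hi y) (and_congr (hu y) ?_)))
    refine exists_congr fun j => and_congr_right fun _ => and_congr ?_ ?_
    · rw [iterate_apply_equiv hs, f.apply_eq_iff_eq]
    · refine forall_congr' fun i => imp_congr_right fun _ => imp_congr_right fun _ => ?_
      rw [iterate_apply_equiv hs, hu]

end ClosureEquiv

theorem Pearl.val_succ {V : Type*} {word : V → List Letter} (x : Pearl word) :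
    (x.succ.2 : ℕ) = ((x.2 : ℕ) + 1) % ((word x.1).length + 1) := by
  obtain ⟨v, i⟩ := x
  show ((i + 1 : Fin ((word v).length + 1)) : ℕ) = _
  rw [Fin.val_add, Fin.val_one', Nat.add_mod_mod]

namespace PearlGraph

namespace Iso

variable {V W : Type*} {m : PearlGraph V} {m' : PearlGraph W} (f : Iso m m')

theorem kind_eq (x : Pearl m.word) : (f.onPearls x).kind = x.kind :=
  Pearl.kind_congr ((congrArg m'.word (f.vertex_eq x)).trans (f.word_eq x.1)) (f.position_eq x)

theorem length_eq (x : Pearl m.word) :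
    (m'.word (f.onPearls x).1).length = (m.word x.1).length := by
  rw [f.vertex_eq, f.word_eq]

theorem succ_eq (x : Pearl m.word) : (f.onPearls x).succ = f.onPearls x.succ := by
  refine Pearl.ext_of_val ?_ ?_
  · exact (f.vertex_eq x).trans (f.vertex_eq x.succ).symm
  · rw [f.position_eq, Pearl.val_succ, Pearl.val_succ, f.position_eq, f.length_eq]

theorem pred_eq (x : Pearl m.word) : (f.onPearls x).pred = f.onPearls x.pred := by
  have h := f.succ_eq x.pred
  have h1 : x.pred.succ = x := (succPerm m.word).apply_symm_apply x
  rw [h1] at h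
  rw [← h]
  exact (succPerm m'.word).symm_apply_apply _

theorem joined_iff (x y : Pearl m.word) :
    m'.Joined (f.onPearls x) (f.onPearls y) ↔ m.Joined x y :=
  or_congr (f.edge_iff x y) (f.edge_iff y x)

theorem isFree_iff (x : Pearl m.word) : m'.IsFree (f.onPearls x) ↔ m.IsFree x := by
  constructor
  · intro h y hy
    exact h _ ((f.joined_iff x y).2 hy)
  · intro h y hy
    obtain ⟨y, rfl⟩ := f.onPearls.surjective y
    exact h _ ((f.joined_iff x y).1 hy)

variable (hm : m.IsMatching) (hm' : m'.IsMatching)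
include hm hm'

/-- `mate` rests on a choice, but in a matching the choice is forced, so isomorphisms respect it. -/
theorem mate_eq (x : Pearl m.word) : m'.mate (f.onPearls x) = f.onPearls (m.mate x) := by
  by_cases h : m.IsFree x
  · rw [mate_of_isFree h, mate_of_isFree ((f.isFree_iff x).2 h)]
  · obtain ⟨y, hy⟩ := not_forall_not.1 h
    rw [hm.mate_eq hy, hm'.mate_eq ((f.joined_iff x y).2 hy)]

/-- Rewiring is compatible with isomorphisms. -/
def rewire : Iso m.rewire m'.rewire where
  onVertices := f.onVertices
  onPearls := f.onPearls
  word_eq := f.word_eq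
  vertex_eq := f.vertex_eq
  position_eq := f.position_eq
  edge_iff x y := by
    refine and_congr (or_congr (f.edge_iff x y) (apply_mem_closurePairs (f := f.onPearls)
      (fun z => ?_) (fun z => ?_) (fun z => ?_) x y)) (not_congr (and_congr ?_ ?_))
    · change (m'.mate (f.onPearls z)).succ = f.onPearls (m.mate z).succ
      rw [f.mate_eq hm hm', f.succ_eq]
    · exact Eq.congr_left (f.kind_eq z)
    · exact Eq.congr_left (f.kind_eq z)
    · exact Eq.congr_left (f.kind_eq x)
    · exact Eq.congr_left (f.kind_eq y)
  root_eq := f.root_eq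

/-- Inverse rewiring is compatible with isomorphisms. -/
def invRewire : Iso m.invRewire m'.invRewire where
  onVertices := f.onVertices
  onPearls := f.onPearls
  word_eq := f.word_eq
  vertex_eq := f.vertex_eq
  position_eq := f.position_eq
  edge_iff x y := by
    refine and_congr (or_congr (f.edge_iff x y) (apply_mem_closurePairs (f := f.onPearls)
      (fun z => ?_) (fun z => ?_) (fun z => ?_) x y)) (not_congr (and_congr ?_ ?_))
    · change (m'.mate (f.onPearls z)).pred = f.onPearls (m.mate z).pred
      rw [f.mate_eq hm hm', f.pred_eq]
    · exact Eq.congr_left (f.kind_eq z)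
    · exact and_congr (Eq.congr_left (f.kind_eq z)) (f.isFree_iff z)
    · exact Eq.congr_left (f.kind_eq x)
    · exact Eq.congr_left (f.kind_eq y)
  root_eq := f.root_eq

end Iso

theorem nonempty_iso_of_toClass_eq {n n' : ℕ} {m : PearlGraph (Fin n)} {m' : PearlGraph (Fin n')}
    (h : m.toClass = m'.toClass) : Nonempty (Iso m m') := Quotient.exact h

theorem toClass_eq_of_iso {n n' : ℕ} {m : PearlGraph (Fin n)} {m' : PearlGraph (Fin n')}
    (f : Iso m m') : m.toClass = m'.toClass := Quotient.sound (s := pearlGraphSetoid) ⟨f⟩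

theorem IsNonnegQTree.toClass_rewire {Q : Set (List Letter)} {n n' : ℕ} {m : PearlGraph (Fin n)}
    {m' : PearlGraph (Fin n')} (h : m.IsNonnegQTree Q) (h' : m'.IsNonnegQTree Q)
    (hc : m.toClass = m'.toClass) : m.rewire.toClass = m'.rewire.toClass := by
  obtain ⟨f⟩ := nonempty_iso_of_toClass_eq hc
  exact toClass_eq_of_iso (f.rewire h.isMatching h'.isMatching)

theorem IsBalancedCompanionTree.toClass_invRewire {Q : Set (List Letter)} {k n n' : ℕ}
    {m : PearlGraph (Fin n)} {m' : PearlGraph (Fin n')} (h : m.IsBalancedCompanionTree Q k)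
    (h' : m'.IsBalancedCompanionTree Q k) (hc : m.toClass = m'.toClass) :
    m.invRewire.toClass = m'.invRewire.toClass := by
  obtain ⟨f⟩ := nonempty_iso_of_toClass_eq hc
  exact toClass_eq_of_iso (f.invRewire (h.toIsCompanionTree.isMatching h.balanced.1)
    (h'.toIsCompanionTree.isMatching h'.balanced.1))

end PearlGraph

end Rewiring

/-! ### The bijection on isomorphism classes. -/

theorem mainTheorem1 (Q : Set (List Rewiring.Letter)) (k : ℕ) :
    ∃ Φ : Rewiring.nonnegQTrees Q k ≃ Rewiring.balancedCompanionTrees Q k,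
      (∀ (n : ℕ) (τ : Rewiring.PearlGraph (Fin n)) (h : τ.IsNonnegQTree Q) (hk : τ.excess = k),
        (Φ ⟨τ.toClass, n, τ, h, hk, rfl⟩ : Rewiring.PearlGraphClass) = τ.rewire.toClass) ∧
      (∀ (n : ℕ) (τ' : Rewiring.PearlGraph (Fin n)) (h : τ'.IsBalancedCompanionTree Q k),
        (Φ.symm ⟨τ'.toClass, n, τ', h, rfl⟩ : Rewiring.PearlGraphClass) = τ'.invRewire.toClass) ∧
      ∀ c : Rewiring.nonnegQTrees Q k,
        Rewiring.necklaces (Φ c : Rewiring.PearlGraphClass) = Rewiring.necklaces c := by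
  -- The map is defined on chosen representatives; invariance under isomorphism gives its value on
  -- every other representative.
  choose N τ hτ hk hτc using fun c : Rewiring.nonnegQTrees Q k => c.2
  choose M σ hσ hσc using fun c : Rewiring.balancedCompanionTrees Q k => c.2
  have hτ' := fun c => (hτ c).isBalancedCompanionTree_rewire (hk c)
  have hσ' := fun c => (hσ c).isNonnegQTree_invRewire
  let Φ : Rewiring.nonnegQTrees Q k ≃ Rewiring.balancedCompanionTrees Q k :=
    { toFun := fun c => ⟨(τ c).rewire.toClass, N c, (τ c).rewire, (hτ' c).1, rfl⟩
      invFun := fun c =>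
        ⟨(σ c).invRewire.toClass, M c, (σ c).invRewire, (hσ' c).1, (hσ' c).2.1, rfl⟩
      left_inv := fun c => Subtype.ext <| by
        dsimp only
        rw [(hσ _).toClass_invRewire (hτ' c).1 (hσc _), (hτ' c).2, hτc]
      right_inv := fun c => Subtype.ext <| by
        dsimp only
        rw [(hτ _).toClass_rewire (hσ' c).1 (hτc _), (hσ' c).2.2, hσc] }
  refine ⟨Φ, fun n t h hk' => (hτ _).toClass_rewire h (hτc _),
    fun n t h => (hσ _).toClass_invRewire h (hσc _), fun c => ?_⟩
  -- Rewiring leaves the field `word` untouched, so both sides are the same multiset by definition.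
  conv_rhs => rw [← hτc c]
  rfl
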